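/- Let $\tau\in\mathbb C$ with $\operatorname{Im}\tau>0$, and let $$\theta_1(x)=-\sum_{k\in\mathbb Z}\exp\Bigl(\pi i\tau\bigl(k+\tfrac12\bigr)^2+2\pi i\bigl(x+\tfrac12\bigr)\bigl(k+\tfrac12\bigr)\Bigr)$$ be the odd Jacobi theta function. Let $\ell\ge 1$ be an integer and let $\eta\in\mathbb C$ be generic in the sense that $\theta_1(j\eta)\ne 0$ for $1\le j\le 2\ell$. Write $$[j]=\frac{\theta_1(j\eta)}{\theta_1(\eta)},\qquad [n]!=\prod_{j=1}^n[j],\qquad \begin{bmatrix}n\\m\end{bmatrix}=\frac{[n]!}{[m]!\,[n-m]!},\qquad \Phi(x,\zeta)=\frac{\theta_1(\zeta+x)}{\theta_1(x)\theta_1(\zeta)} .$$ For $0\le s\le \ell$ define $$A^{(\ell)}_{\ell-s}(E)=\begin{bmatrix}\ell\\s\end{bmatrix}\begin{bmatrix}2\ell\\s\end{bmatrix}^{-1}\det\left(E\,\delta_{i,j}+\frac{[-i]}{[\ell+1-i]}\,\delta_{i,j-1}+\frac{[2\ell+2-i]}{[\ell+1-i]}\,\delta_{i,j+1}\right)_{1\le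 i,j\le s}$$ (the empty determinant being $1$). (a) Let $\zeta,K,E\in\mathbb C$ with $\theta_1(\zeta)\ne0$ and $K\neq 0$, and let $K^{x/\eta}=e^{\kappa x/\eta}$ for any fixed $\kappa$ with $e^\kappa=K$. The difference Lamé equation $$\psi(x+\eta)+\frac{\theta_1(x+\ell\eta)\,\theta_1(x-(\ell+1)\eta)}{\theta_1(x)\,\theta_1(x-\eta)}\,\psi(x-\eta)=E\,\psi(x)$$ (an identity of meromorphic functions of $x$) has a solution, not identically zero, of the form $$\psi(x)=K^{x/\eta}\sum_{j=1}^{\ell}s_j\,\Phi(x-j\eta,\zeta),\qquad s_1,\dots,s_\ell\in\mathbb C,$$ which is double-Bloch, $\psi(x+1)=K^{1/\eta}\psi(x)$ and $\psi(x+\tau)=K^{\tau/\eta}e^{-2\pi i\zeta}\psi(x)$, if and only if $$\sum_{j=0}^{\ell}(-1)^jK^{-j}\,\theta_1(\zeta-j\eta)\begin{bmatrix}\ell\\j\end{bmatrix}A^{(\ell)}_j(E)=0 \quad\text{and}\quad \sum_{j=0}^{\ell+1}(-1)^jK^{-j}\,\theta_1(\zeta-j\eta)\,[j-1]\begin{bmatrix}\ell+1\\j\end{bmatrix}A^{(\ell)}_{|j-1|}(E)=0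 .$$ (b) For $0\le j\le\ell$, $A^{(\ell)}_j$ is a polynomial in $E$ of degree exactly $\ell-j$, and $A^{(\ell)}_\ell=1$. (c) The polynomials $A^{(\ell)}_0,\dots,A^{(\ell)}_\ell$ are equivalently given by the three-term recurrence: polynomials $P_0,\dots,P_\ell\in\mathbb C[E]$ satisfy $P_\ell=1$, $P_{\ell-1}=\frac{[\ell]}{[2\ell]}E$ and $$P_{\ell-s-1}=\frac{[\ell-s]}{[2\ell-s]}\,E\,P_{\ell-s}+\frac{[s]}{[2\ell-s]}\,P_{\ell-s+1}\qquad(1\le s\le\ell-1)$$ if and only if $P_j=A^{(\ell)}_j$ for all $0\le j\le\ell$. -/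

import Mathlib

noncomputable section

namespace DifferenceLame

/-- The odd Jacobi theta function `θ₁(x | τ)`, with quasi-periods `1` and `τ`. -/
def theta1 (τ x : ℂ) : ℂ :=
  -∑' k : ℤ, Complex.exp (Real.pi * Complex.I * τ * ((k : ℂ) + 1 / 2) ^ 2
      + 2 * Real.pi * Complex.I * (x + 1 / 2) * ((k : ℂ) + 1 / 2))

/-- The elliptic number `[n] = θ₁(nη) / θ₁(η)`. -/
def ellNum (τ η : ℂ) (n : ℤ) : ℂ :=
  theta1 τ (n * η) / theta1 τ η

/-- The elliptic factorial `[n]! = [1][2]⋯[n]`. -/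
def ellFact (τ η : ℂ) (n : ℕ) : ℂ :=
  ∏ j ∈ Finset.Icc 1 n, ellNum τ η j

/-- The elliptic binomial coefficient `[n]! / ([m]! [n-m]!)`, for `m ≤ n`. -/
def ellBinom (τ η : ℂ) (n m : ℕ) : ℂ :=
  ellFact τ η n / (ellFact τ η m * ellFact τ η (n - m))

/-- The function `Φ(x, ζ) = θ₁(ζ + x) / (θ₁(x) θ₁(ζ))`. -/
def Phi (τ x ζ : ℂ) : ℂ :=
  theta1 τ (ζ + x) / (theta1 τ x * theta1 τ ζ)

/-- The coefficient `θ₁(x+ℓη) θ₁(x-(ℓ+1)η) / (θ₁(x) θ₁(x-η))` of the difference Lamé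
equation. -/
def lameCoeff (τ η : ℂ) (ℓ : ℕ) (x : ℂ) : ℂ :=
  theta1 τ (x + ℓ * η) * theta1 τ (x - (ℓ + 1) * η) / (theta1 τ x * theta1 τ (x - η))

/-- The points `x` at which none of `ψ(x+η)`, `ψ(x)`, `ψ(x-η)` and the coefficient of the
equation has a pole, for a function `ψ` with poles at most at `η, 2η, …, ℓη` modulo the
period lattice. -/
def IsRegularPoint (τ η : ℂ) (ℓ : ℕ) (x : ℂ) : Prop :=
  ∀ j : ℕ, j ≤ ℓ + 1 → theta1 τ (x - j * η) ≠ 0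

/-- `ψ` solves `ψ(x+η) + c(x) ψ(x-η) = E ψ(x)`, as an identity of meromorphic functions whose
poles are excluded by `IsRegularPoint`. -/
def SolvesLame (τ η : ℂ) (ℓ : ℕ) (E : ℂ) (ψ : ℂ → ℂ) : Prop :=
  ∀ x : ℂ, IsRegularPoint τ η ℓ x →
    ψ (x + η) + lameCoeff τ η ℓ x * ψ (x - η) = E * ψ x

/-- `ψ` is double-Bloch with the multipliers `B₁`, `Bτ` for the periods `1`, `τ`. -/
def IsDoubleBloch (τ B₁ Bτ : ℂ) (ψ : ℂ → ℂ) : Prop :=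
  ∀ x : ℂ, ψ (x + 1) = B₁ * ψ x ∧ ψ (x + τ) = Bτ * ψ x

/-- The function `K^{x/η} ∑_{j=1}^ℓ s_j Φ(x - jη, ζ)`, where `K^{x/η} = exp (κ x / η)` for a
logarithm `κ` of `K`. -/
def ansatz (τ η : ℂ) (ℓ : ℕ) (κ ζ : ℂ) (s : ℕ → ℂ) (x : ℂ) : ℂ :=
  Complex.exp (κ * x / η) * ∑ j ∈ Finset.Icc 1 ℓ, s j * Phi τ (x - j * η) ζ

/-- The equation with energy `E` has a solution of the form `ansatz` that is not identically
zero; it is double-Bloch with multipliers `K^{1/η}` and `K^{τ/η} e^{-2πiζ}`. -/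
def HasDoubleBlochSolution (τ η : ℂ) (ℓ : ℕ) (κ ζ E : ℂ) : Prop :=
  ∃ s : ℕ → ℂ,
    (∃ x : ℂ, IsRegularPoint τ η ℓ x ∧ ansatz τ η ℓ κ ζ s x ≠ 0) ∧
    IsDoubleBloch τ (Complex.exp (κ / η))
      (Complex.exp (κ * τ / η) * Complex.exp (-(2 * Real.pi * Complex.I * ζ)))
      (ansatz τ η ℓ κ ζ s) ∧
    SolvesLame τ η ℓ E (ansatz τ η ℓ κ ζ s)

/-- The `s × s` tridiagonal matrix with rows and columns `i, j = 1, …, s` and entries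
`E δ_{i,j} + [-i]/[ℓ+1-i] δ_{i,j-1} + [2ℓ+2-i]/[ℓ+1-i] δ_{i,j+1}`; `E` is the polynomial
variable, and `a, b : Fin s` stand for `i = a + 1`, `j = b + 1`. -/
def lameMatrix (τ η : ℂ) (ℓ s : ℕ) : Matrix (Fin s) (Fin s) (Polynomial ℂ) :=
  Matrix.of fun a b =>
    let i : ℤ := (a : ℕ) + 1
    let j : ℤ := (b : ℕ) + 1
    (if i = j then Polynomial.X else 0)
      + (if i = j - 1 then
          Polynomial.C (ellNum τ η (-i) / ellNum τ η (ℓ + 1 - i)) else 0)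
      + (if i = j + 1 then
          Polynomial.C (ellNum τ η (2 * ℓ + 2 - i) / ellNum τ η (ℓ + 1 - i)) else 0)

/-- The polynomial `A_j^{(ℓ)}(E)`, `0 ≤ j ≤ ℓ`, by the determinant formula with `s = ℓ - j`. -/
def lameA (τ η : ℂ) (ℓ j : ℕ) : Polynomial ℂ :=
  Polynomial.C (ellBinom τ η ℓ (ℓ - j) * (ellBinom τ η (2 * ℓ) (ℓ - j))⁻¹)
    * (lameMatrix τ η ℓ (ℓ - j)).det

/-- The left-hand side of the first equation of the spectral curve. -/
def spectral1 (τ η : ℂ) (ℓ : ℕ) (ζ K E : ℂ) : ℂ :=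
  ∑ j ∈ Finset.range (ℓ + 1),
    (-1) ^ j * K ^ (-(j : ℤ)) * theta1 τ (ζ - j * η) * ellBinom τ η ℓ j
      * (lameA τ η ℓ j).eval E

/-- The left-hand side of the second equation of the spectral curve; `((j : ℤ) - 1).natAbs` is
the index `|j - 1|`. -/
def spectral2 (τ η : ℂ) (ℓ : ℕ) (ζ K E : ℂ) : ℂ :=
  ∑ j ∈ Finset.range (ℓ + 2),
    (-1) ^ j * K ^ (-(j : ℤ)) * theta1 τ (ζ - j * η) * ellNum τ η ((j : ℤ) - 1)
      * ellBinom τ η (ℓ + 1) j * (lameA τ η ℓ ((j : ℤ) - 1).natAbs).eval E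

/-- The three-term recurrence with its initial conditions, for a family `P_0, …, P_ℓ`. -/
def SatisfiesRecurrence (τ η : ℂ) (ℓ : ℕ) (P : ℕ → Polynomial ℂ) : Prop :=
  P ℓ = 1 ∧
  P (ℓ - 1) = Polynomial.C (ellNum τ η ℓ / ellNum τ η (2 * ℓ)) * Polynomial.X ∧
  ∀ s : ℕ, 1 ≤ s → s + 1 ≤ ℓ →
    P (ℓ - s - 1) =
      Polynomial.C (ellNum τ η (ℓ - s) / ellNum τ η (2 * ℓ - s)) * Polynomial.X * P (ℓ - s)
        + Polynomial.C (ellNum τ η s / ellNum τ η (2 * ℓ - s)) * P (ℓ - s + 1)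

end DifferenceLame

end

noncomputable section

namespace DifferenceLame

/-! ### Quasi-periodicity and oddness of `theta1`. -/

section Theta

open Complex Filter Topology

/-! Divide the Lamé equation by `K^{x/η}`. The difference of its two sides, `lameDefect`, has
multipliers 1 and `e^{-2πiζ}` for the periods 1 and τ. Modulo the lattice, its poles are at most
simple and lie at mη, 0 ≤ m ≤ ℓ+1. If all residues vanish it is entire, hence an exponential by
Liouville. A nonzero exponential of period 1 has multiplier `e^{2πinτ}` at τ, which would put ζ on
the lattice and contradict θ₁(ζ) ≠ 0. So the equation is equivalent to the vanishing of finitely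
many residues (`lameDefect_eq_zero_iff`), and the one at (ℓ+1)η vanishes by itself.

The residues at 2η, …, ℓη form a three-term recursion that determines s_{ℓ-1}, …, s_1 from s_ℓ. Up
to powers of -K and elliptic binomials it is the recurrence of the polynomials A_j, so s is a
multiple of `lameSol` (`eq_lameSol_of_lameResidue_eq_zero`). For this s the residues at η and 0 are
nonzero multiples of the two spectral expressions (`lameResidue_lameSol_one`,
`lameResidue_lameSol_zero`).

The recurrence for A_j comes from expanding the tridiagonal determinant. It gives the degrees by
induction and, read downwards from A_ℓ = 1, uniqueness.

The analysis requires that θ₁ vanish only on the lattice, with a simple zero at 0. Both facts are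
read off an infinite product that equals θ₁ up to an exponential and a constant
(`theta1_eq_const_mul_thetaProd`). -/

theorem theta1_eq_jacobiTheta₂ (τ x : ℂ) :
    theta1 τ x = -(exp (Real.pi * I * τ / 4 + Real.pi * I * (x + 1 / 2)) *
      jacobiTheta₂ (x + 1 / 2 + τ / 2) τ) := by
  rw [theta1, jacobiTheta₂, ← tsum_mul_left]
  congr 2
  ext k
  rw [jacobiTheta₂_term, ← exp_add]
  ring_nf

theorem differentiable_theta1 {τ : ℂ} (hτ : 0 < τ.im) : Differentiable ℂ (theta1 τ) := by
  intro x
  have h : theta1 τ = fun x => -(exp (Real.pi * I * τ / 4 + Real.pi * I * (x + 1 / 2)) *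
      jacobiTheta₂ (x + 1 / 2 + τ / 2) τ) := funext (theta1_eq_jacobiTheta₂ τ)
  rw [h]
  have h1 := (differentiableAt_jacobiTheta₂_fst (x + 1 / 2 + τ / 2) hτ).comp x
    (f := fun x : ℂ => x + 1 / 2 + τ / 2) (by fun_prop)
  exact (DifferentiableAt.mul (by fun_prop) h1).neg

theorem theta1_add_one (τ x : ℂ) : theta1 τ (x + 1) = -theta1 τ x := by
  rw [theta1_eq_jacobiTheta₂, theta1_eq_jacobiTheta₂,
    show x + 1 + 1 / 2 + τ / 2 = x + 1 / 2 + τ / 2 + 1 by ring, jacobiTheta₂_add_left,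
    show (Real.pi * I * τ / 4 + Real.pi * I * (x + 1 + 1 / 2) : ℂ) =
      Real.pi * I * τ / 4 + Real.pi * I * (x + 1 / 2) + Real.pi * I by ring,
    exp_add _ (Real.pi * I), exp_pi_mul_I]
  ring

theorem theta1_add_tau (τ x : ℂ) :
    theta1 τ (x + τ) = -exp (-(Real.pi * I * τ + 2 * Real.pi * I * x)) * theta1 τ x := by
  rw [theta1_eq_jacobiTheta₂, theta1_eq_jacobiTheta₂,
    show x + τ + 1 / 2 + τ / 2 = x + 1 / 2 + τ / 2 + τ by ring, jacobiTheta₂_add_left']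
  have : -exp (-(Real.pi * I * τ + 2 * Real.pi * I * x)) =
      exp (-(Real.pi * I * τ + 2 * Real.pi * I * x) - Real.pi * I) := by
    rw [exp_sub, exp_pi_mul_I]; ring
  rw [this, neg_mul_eq_mul_neg, ← neg_mul_eq_mul_neg, ← neg_mul_eq_mul_neg, ← mul_assoc,
    ← mul_assoc, ← exp_add, ← exp_add]
  ring_nf

theorem theta1_neg (τ x : ℂ) : theta1 τ (-x) = -theta1 τ x := by
  rw [theta1_eq_jacobiTheta₂, theta1_eq_jacobiTheta₂,
    -- Reflection in the shifted argument costs only the lattice translation τ + 1, so evenness of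
    -- `jacobiTheta₂` applies.
    show -x + 1 / 2 + τ / 2 = -(x + 1 / 2 + τ / 2) + τ + 1 by ring, jacobiTheta₂_add_left,
    jacobiTheta₂_add_left', jacobiTheta₂_neg_left, ← mul_assoc, ← exp_add, neg_neg,
    ← neg_mul]
  congr 1
  rw [show (Real.pi * I * τ / 4 + Real.pi * I * (-x + 1 / 2) +
      -Real.pi * I * (τ + 2 * -(x + 1 / 2 + τ / 2)) : ℂ) =
      Real.pi * I * τ / 4 + Real.pi * I * (x + 1 / 2) + Real.pi * I by ring,
    exp_add _ (Real.pi * I), exp_pi_mul_I]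
  ring

@[simp] theorem theta1_zero (τ : ℂ) : theta1 τ 0 = 0 := by
  have h := theta1_neg τ 0
  rw [neg_zero] at h
  linear_combination h / 2

end Theta

/-! ### Liouville-type theorems for quasi-periodic functions. -/

section Liouville

open Complex Filter Topology

/-- A meromorphic function without genuine poles agrees with an entire function. -/
theorem exists_entire_eventuallyEq {F : ℂ → ℂ} (hF : ∀ p, MeromorphicAt F p)
    (h0 : ∀ p, Tendsto (fun z => (z - p) * F z) (𝓝[≠] p) (𝓝 0)) :
    ∃ h : ℂ → ℂ, Differentiable ℂ h ∧ ∀ p, h =ᶠ[𝓝[≠] p] F := by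
  have hU : MeromorphicOn F Set.univ := fun p _ => hF p
  refine ⟨toMeromorphicNFOn F Set.univ, fun p => ?_, fun p => ?_⟩
  · have hnf : MeromorphicNFAt (toMeromorphicNFOn F Set.univ) p :=
      meromorphicNFOn_toMeromorphicNFOn F Set.univ (Set.mem_univ p)
    refine (hnf.meromorphicOrderAt_nonneg_iff_analyticAt.1 ?_).differentiableAt
    rw [meromorphicOrderAt_toMeromorphicNFOn hU (Set.mem_univ p)]
    have hid : MeromorphicAt (fun z => z - p) p := by fun_prop
    have hord : meromorphicOrderAt (fun z => z - p) p = (1 : ℤ) := by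
      rw [meromorphicOrderAt_eq_int_iff hid]
      exact ⟨fun _ => 1, analyticAt_const, one_ne_zero, by simp⟩
    have hpos := (tendsto_zero_iff_meromorphicOrderAt_pos (hid.mul (hF p))).1 (h0 p)
    rw [meromorphicOrderAt_mul hid (hF p), hord] at hpos
    cases hn : meromorphicOrderAt F p with
    | top => simp
    | coe n =>
      rw [hn] at hpos
      norm_cast at hpos ⊢
      omega
  · exact hU.toMeromorphicNFOn_eq_self_on_nhdsNE (Set.mem_univ p)

theorem eq_of_eventuallyEq_punctured {f g : ℂ → ℂ} {p : ℂ} (hf : ContinuousAt f p)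
    (hg : ContinuousAt g p) (h : f =ᶠ[𝓝[≠] p] g) : f p = g p :=
  tendsto_nhds_unique_of_eventuallyEq (hf.tendsto.mono_left nhdsWithin_le_nhds)
    (hg.tendsto.mono_left nhdsWithin_le_nhds) h

/-- Quotients take the default value 0 where a denominator vanishes, so the entire extension h need
not equal F there. The functional equation passes to h by continuity from punctured neighbourhoods.
-/
theorem quasiPeriodic_of_eventuallyEq {h F : ℂ → ℂ} (hh : Continuous h)
    (hF : ∀ p, h =ᶠ[𝓝[≠] p] F) {ω μ : ℂ} (hper : ∀ x, F (x + ω) = μ * F x) (x : ℂ) :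
    h (x + ω) = μ * h x := by
  refine eq_of_eventuallyEq_punctured (f := fun x => h (x + ω)) (g := fun x => μ * h x)
    (by fun_prop) (by fun_prop) ?_
  have ht : Tendsto (fun y : ℂ => y + ω) (𝓝[≠] x) (𝓝[≠] (x + ω)) :=
    (continuous_add_const ω).continuousAt.continuousWithinAt.tendsto_nhdsWithin
      (fun y hy => by simpa using hy)
  filter_upwards [ht.eventually (hF (x + ω)), hF x] with y h1 h2
  rw [h1, h2, hper]

theorem add_lattice_of_quasiPeriodic {F : ℂ → ℂ} {τ α β : ℂ} (hα : α ≠ 0) (hβ : β ≠ 0)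
    (h1 : ∀ x, F (x + 1) = α * F x) (hτ : ∀ x, F (x + τ) = β * F x) (a b : ℤ) (x : ℂ) :
    F (x + (a + b * τ)) = α ^ a * β ^ b * F x := by
  have key : ∀ (ω γ : ℂ), γ ≠ 0 → (∀ x, F (x + ω) = γ * F x) → ∀ (n : ℤ) (x : ℂ),
      F (x + n * ω) = γ ^ n * F x := by
    intro ω γ hγ h n
    induction n with
    | zero => simp
    | succ n ih =>
      intro x
      rw [show x + ((n + 1 : ℤ) : ℂ) * ω = x + ((n : ℤ) : ℂ) * ω + ω by push_cast; ring, h, ih,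
        zpow_add_one₀ hγ]
      ring
    | pred n ih =>
      intro x
      have := h (x + ((-n - 1 : ℤ) : ℂ) * ω)
      rw [show x + ((-n - 1 : ℤ) : ℂ) * ω + ω = x + ((-n : ℤ) : ℂ) * ω by push_cast; ring,
        ih] at this
      rw [zpow_sub_one₀ hγ]
      field_simp
      rw [this, mul_comm]
  rw [← add_assoc, key τ β hβ hτ, ← mul_one (a : ℂ), key 1 α hα h1]
  ring

/-- With unimodular multipliers |g| is doubly periodic, hence bounded by its maximum on the closed
period parallelogram. -/
theorem bounded_of_quasiPeriodic {τ : ℂ} (hτ : 0 < τ.im) {g : ℂ → ℂ} (hg : Continuous g)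
    {α β : ℂ} (hα : ‖α‖ = 1) (hβ : ‖β‖ = 1)
    (h1 : ∀ x, g (x + 1) = α * g x) (h2 : ∀ x, g (x + τ) = β * g x) :
    Bornology.IsBounded (Set.range g) := by
  have hα0 : α ≠ 0 := fun h => by simp [h] at hα
  have hβ0 : β ≠ 0 := fun h => by simp [h] at hβ
  have hK : IsCompact ((fun p : ℝ × ℝ => (p.1 : ℂ) + p.2 * τ) ''
      (Set.Icc (0 : ℝ) 1 ×ˢ Set.Icc (0 : ℝ) 1)) :=
    (isCompact_Icc.prod isCompact_Icc).image (by fun_prop)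
  obtain ⟨C, hC⟩ := hK.exists_bound_of_continuousOn hg.continuousOn
  rw [isBounded_iff_forall_norm_le]
  refine ⟨C, ?_⟩
  rintro _ ⟨x, rfl⟩
  set v : ℝ := x.im / τ.im
  set u : ℝ := x.re - v * τ.re
  have hx : x = (u : ℂ) + v * τ := by
    apply Complex.ext
    · simp [u]
    · simp [v, hτ.ne']
  have hx' : x = (((Int.fract u : ℝ) : ℂ) + (Int.fract v : ℝ) * τ) + ((⌊u⌋ : ℂ) + (⌊v⌋ : ℂ) * τ) := by
    have hu : (u : ℂ) = (⌊u⌋ : ℂ) + ((Int.fract u : ℝ) : ℂ) := by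
      exact_mod_cast (Int.floor_add_fract u).symm
    have hv : (v : ℂ) = (⌊v⌋ : ℂ) + ((Int.fract v : ℝ) : ℂ) := by
      exact_mod_cast (Int.floor_add_fract v).symm
    rw [hx]
    linear_combination hu + τ * hv
  rw [hx', add_lattice_of_quasiPeriodic hα0 hβ0 h1 h2]
  simp only [norm_mul, norm_zpow, hα, hβ, one_zpow, one_mul]
  exact hC _ ⟨(Int.fract u, Int.fract v), ⟨⟨Int.fract_nonneg _, (Int.fract_lt_one _).le⟩,
    ⟨Int.fract_nonneg _, (Int.fract_lt_one _).le⟩⟩, rfl⟩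

/-- An entire function with period `1` and a constant multiplier for the period `τ` is an
exponential. -/
theorem exists_exp_of_quasiPeriodic {τ : ℂ} (hτ : 0 < τ.im) {h : ℂ → ℂ}
    (hh : Differentiable ℂ h) {μ : ℂ} (hμ : μ ≠ 0) (h1 : ∀ x, h (x + 1) = h x)
    (h2 : ∀ x, h (x + τ) = μ * h x) :
    ∃ a C : ℂ, ∀ x, h x = C * exp (a * x) := by
  -- For this real t, `|exp (itτ)| = 1/‖μ‖` and `|exp (it)| = 1`, so multiplying h by `exp (itx)`
  -- makes both multipliers unimodular.
  set t : ℝ := Real.log ‖μ‖ / τ.im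
  set g : ℂ → ℂ := fun x => exp (t * I * x) * h x with hgdef
  have hgd : Differentiable ℂ g := by fun_prop
  have hb : Bornology.IsBounded (Set.range g) := by
    refine bounded_of_quasiPeriodic hτ hgd.continuous (α := exp (t * I)) (β := exp (t * I * τ) * μ)
      ?_ ?_ ?_ ?_
    · rw [norm_exp_ofReal_mul_I]
    · rw [norm_mul, norm_exp]
      have : (t * I * τ : ℂ).re = -Real.log ‖μ‖ := by
        simp [t, hτ.ne']
      rw [this, Real.exp_neg, Real.exp_log (norm_pos_iff.2 hμ),
        inv_mul_cancel₀ (norm_ne_zero_iff.2 hμ)]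
    · intro x
      simp only [hgdef, h1, mul_add, exp_add, mul_one]
      ring
    · intro x
      simp only [hgdef, h2, mul_add, exp_add]
      ring
  obtain ⟨C, hC⟩ := hgd.exists_const_forall_eq_of_bounded hb
  refine ⟨-(t * I), C, fun x => ?_⟩
  have := hC x
  rw [← this, hgdef]
  simp only
  rw [mul_comm, ← mul_assoc, ← exp_add]
  simp

/-- Period 1 forces the exponent a in `C * exp (a * x)` into 2πiℤ, and translation by τ then reads
off μ. -/
theorem exp_int_mul_of_quasiPeriodic {τ : ℂ} (hτ : 0 < τ.im) {h : ℂ → ℂ}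
    (hh : Differentiable ℂ h) {μ : ℂ} (hμ : μ ≠ 0) (h1 : ∀ x, h (x + 1) = h x)
    (h2 : ∀ x, h (x + τ) = μ * h x) (x₀ : ℂ) (hx₀ : h x₀ ≠ 0) :
    ∃ n : ℤ, exp (n * (2 * Real.pi * I) * τ) = μ := by
  obtain ⟨a, C, hC⟩ := exists_exp_of_quasiPeriodic hτ hh hμ h1 h2
  have e1 := h1 x₀
  have e2 := h2 x₀
  have hC0 : C * exp (a * x₀) ≠ 0 := by rw [← hC]; exact hx₀
  simp only [hC, mul_add, exp_add, mul_one] at e1 e2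
  have ha : exp a = 1 := by
    apply mul_left_cancel₀ hC0
    linear_combination e1
  obtain ⟨n, hn⟩ := exp_eq_one_iff.1 ha
  refine ⟨n, ?_⟩
  rw [← hn]
  apply mul_left_cancel₀ hC0
  linear_combination e2

theorem const_of_doublyPeriodic {τ : ℂ} (hτ : 0 < τ.im) {h : ℂ → ℂ}
    (hh : Differentiable ℂ h) (h1 : ∀ x, h (x + 1) = h x) (h2 : ∀ x, h (x + τ) = h x) :
    ∃ C, ∀ x, h x = C :=
  hh.exists_const_forall_eq_of_bounded
    (bounded_of_quasiPeriodic hτ hh.continuous norm_one norm_one (by simpa using h1)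
      (by simpa using h2))

end Liouville

/-! ### Zeros of θ₁, through its infinite product. -/

section ThetaZeros

open Complex Filter Topology

/-- The `q`-Pochhammer symbol `(z; q)_∞`. -/
def qPochhammer (q z : ℂ) : ℂ := ∏' n : ℕ, (1 + -(q ^ n * z))

theorem summable_norm_pow_mul {q : ℂ} (hq : ‖q‖ < 1) (z : ℂ) :
    Summable fun n : ℕ => ‖-(q ^ n * z)‖ := by
  simp only [norm_neg, norm_mul, norm_pow]
  exact (summable_geometric_of_lt_one (norm_nonneg _) hq).mul_right _

theorem qPochhammer_eq_mul {q : ℂ} (hq : ‖q‖ < 1) (z : ℂ) :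
    qPochhammer q z = (1 - z) * qPochhammer q (q * z) := by
  rw [qPochhammer, qPochhammer, tprod_eq_zero_mul']
  · simp only [pow_zero, one_mul, pow_succ, mul_assoc, sub_eq_add_neg]
  · have := multipliable_one_add_of_summable (summable_norm_pow_mul hq (q * z))
    simpa only [pow_succ, mul_assoc] using this

theorem qPochhammer_ne_zero {q : ℂ} (hq : ‖q‖ < 1) {z : ℂ} (hz : ∀ n : ℕ, q ^ n * z ≠ 1) :
    qPochhammer q z ≠ 0 :=
  tprod_one_add_ne_zero_of_summable
    (fun n h => hz n (by linear_combination -h)) (summable_norm_pow_mul hq z)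

theorem differentiable_qPochhammer {q : ℂ} (hq : ‖q‖ < 1) : Differentiable ℂ (qPochhammer q) := by
  intro z
  have hsum : Summable fun n : ℕ => ‖q‖ ^ n * (‖z‖ + 1) :=
    (summable_geometric_of_lt_one (norm_nonneg _) hq).mul_right _
  have hz : z ∈ Metric.ball (0 : ℂ) (‖z‖ + 1) := by simp
  have hprod := Summable.hasProdLocallyUniformlyOn_nat_one_add
    (f := fun (n : ℕ) (z : ℂ) => -(q ^ n * z)) (Metric.isOpen_ball (x := (0 : ℂ)) (ε := ‖z‖ + 1))
    hsum (.of_forall fun n x hx => by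
      rw [norm_neg, norm_mul, norm_pow]
      have : ‖x‖ < ‖z‖ + 1 := by simpa using hx
      gcongr) (fun n => by fun_prop)
  exact (hprod.differentiableOn (.of_forall fun _ => by
    simpa [Finset.prod_fn] using DifferentiableOn.finsetProd (fun _ _ => by fun_prop))
    Metric.isOpen_ball).differentiableAt (Metric.isOpen_ball.mem_nhds hz)

/-- The triple product `(z; q)_∞ (q/z; q)_∞` at `q = exp (2πiτ)`, `z = exp (2πix)`, which is
`θ₁` up to an exponential factor. -/
def thetaProd (τ x : ℂ) : ℂ :=
  qPochhammer (exp (2 * Real.pi * I * τ)) (exp (2 * Real.pi * I * x)) *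
    qPochhammer (exp (2 * Real.pi * I * τ)) (exp (2 * Real.pi * I * (τ - x)))

theorem norm_nome_lt_one {τ : ℂ} (hτ : 0 < τ.im) : ‖exp (2 * Real.pi * I * τ)‖ < 1 := by
  rw [norm_exp, Real.exp_lt_one_iff]
  simp
  positivity

theorem differentiable_thetaProd {τ : ℂ} (hτ : 0 < τ.im) : Differentiable ℂ (thetaProd τ) := by
  have h := differentiable_qPochhammer (norm_nome_lt_one hτ)
  exact (h.comp (f := fun x => exp (2 * Real.pi * I * x)) (by fun_prop)).mul
    (h.comp (f := fun x => exp (2 * Real.pi * I * (τ - x))) (by fun_prop))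

theorem exp_two_pi_mul_add_int (x : ℂ) (n : ℤ) :
    exp (2 * Real.pi * I * (x + n)) = exp (2 * Real.pi * I * x) := by
  rw [mul_add, exp_add, show (2 * Real.pi * I * n : ℂ) = n * (2 * Real.pi * I) by ring,
    exp_int_mul_two_pi_mul_I, mul_one]

theorem thetaProd_add_one (τ x : ℂ) : thetaProd τ (x + 1) = thetaProd τ x := by
  have h1 := exp_two_pi_mul_add_int x 1
  have h2 := exp_two_pi_mul_add_int (τ - x) (-1)
  rw [thetaProd, thetaProd, show τ - (x + 1) = τ - x + ((-1 : ℤ) : ℂ) by push_cast; ring, h2,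
    ← h1, Int.cast_one]

/-- The shift z ↦ qz removes the factor 1 - z from the first product and adds 1 - 1/z to the second;
(1 - 1/z)/(1 - z) = -1/z. -/
theorem thetaProd_add_tau {τ : ℂ} (hτ : 0 < τ.im) (x : ℂ) :
    thetaProd τ (x + τ) = -exp (-(2 * Real.pi * I * x)) * thetaProd τ x := by
  have hq := norm_nome_lt_one hτ
  rw [thetaProd, thetaProd, show τ - (x + τ) = -x by ring, mul_add _ x τ, mul_sub, exp_add,
    exp_sub, mul_neg, exp_neg]
  have h1 := qPochhammer_eq_mul hq (exp (2 * Real.pi * I * x))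
  have h2 := qPochhammer_eq_mul hq (exp (2 * Real.pi * I * x))⁻¹
  rw [← div_eq_mul_inv] at h2
  have hz : exp (2 * Real.pi * I * x) ≠ 0 := exp_ne_zero _
  set z := exp (2 * Real.pi * I * x)
  set q := exp (2 * Real.pi * I * τ)
  rw [h1, h2, mul_comm z q]
  field_simp
  ring

/-- An absolutely convergent product vanishes only if one of its factors does, and each factor
vanishes only at lattice points. -/
theorem exists_lattice_of_thetaProd_eq_zero {τ : ℂ} (hτ : 0 < τ.im) {x : ℂ}
    (hx : thetaProd τ x = 0) : ∃ a b : ℤ, x = a + b * τ := by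
  have hq := norm_nome_lt_one hτ
  by_contra! hne
  have h2pi : (2 * Real.pi * I : ℂ) ≠ 0 := two_pi_I_ne_zero
  refine mul_ne_zero (qPochhammer_ne_zero hq fun n hn => ?_)
    (qPochhammer_ne_zero hq fun n hn => ?_) hx
  · rw [← exp_nat_mul, ← exp_add, exp_eq_one_iff] at hn
    obtain ⟨m, hm⟩ := hn
    refine hne m (-n) (mul_left_cancel₀ h2pi ?_)
    push_cast
    linear_combination hm
  · rw [← exp_nat_mul, ← exp_add, exp_eq_one_iff] at hn
    obtain ⟨m, hm⟩ := hn
    refine hne (-m) (n + 1) (mul_left_cancel₀ h2pi ?_)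
    push_cast
    linear_combination -hm

/-- The zero at 0 sits in the single factor 1 - z; the cofactor takes the nonzero value (q; q)_∞²
there. -/
theorem exists_hasDerivAt_thetaProd_zero {τ : ℂ} (hτ : 0 < τ.im) :
    ∃ c : ℂ, c ≠ 0 ∧ HasDerivAt (thetaProd τ) c 0 := by
  have hq := norm_nome_lt_one hτ
  set q := exp (2 * Real.pi * I * τ) with hqdef
  have hd := differentiable_qPochhammer hq
  set g : ℂ → ℂ := fun x => qPochhammer q (q * exp (2 * Real.pi * I * x)) *
    qPochhammer q (exp (2 * Real.pi * I * (τ - x))) with hg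
  have hgd : Differentiable ℂ g :=
    (hd.comp (f := fun x => q * exp (2 * Real.pi * I * x)) (by fun_prop)).mul
      (hd.comp (f := fun x => exp (2 * Real.pi * I * (τ - x))) (by fun_prop))
  have hP : qPochhammer q q ≠ 0 := by
    refine qPochhammer_ne_zero hq fun n hn => ?_
    have : ‖q ^ n * q‖ < 1 := by
      rw [← pow_succ, norm_pow]
      exact pow_lt_one₀ (norm_nonneg _) hq (by omega)
    rw [hn, norm_one] at this
    exact lt_irrefl _ this
  have hg0 : g 0 = qPochhammer q q * qPochhammer q q := by simp [hg, ← hqdef]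
  have hT : thetaProd τ = fun x => (1 - exp (2 * Real.pi * I * x)) * g x := by
    ext x
    rw [thetaProd, qPochhammer_eq_mul hq, hg, ← hqdef]
    ring
  have he : HasDerivAt (fun x : ℂ => 1 - exp (2 * Real.pi * I * x)) (-(2 * Real.pi * I)) 0 := by
    have := (((hasDerivAt_id (0 : ℂ)).const_mul (2 * Real.pi * I)).cexp).const_sub 1
    simpa using this
  refine ⟨-(2 * Real.pi * I) * g 0, mul_ne_zero (neg_ne_zero.2 two_pi_I_ne_zero) ?_, ?_⟩
  · rw [hg0]; exact mul_ne_zero hP hP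
  · rw [hT]
    exact (he.mul (hgd 0).hasDerivAt).congr_deriv (by simp)

/-- The condition of having no pole is invariant under the lattice for a quasi-periodic
function. -/
theorem tendsto_sub_mul_add_lattice {F : ℂ → ℂ} {τ α β : ℂ} (hα : α ≠ 0) (hβ : β ≠ 0)
    (h1 : ∀ x, F (x + 1) = α * F x) (hτ : ∀ x, F (x + τ) = β * F x) {p : ℂ}
    (hp : Tendsto (fun z => (z - p) * F z) (𝓝[≠] p) (𝓝 0)) (a b : ℤ) :
    Tendsto (fun z => (z - (p + (a + b * τ))) * F z) (𝓝[≠] (p + (a + b * τ))) (𝓝 0) := by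
  have ht : Tendsto (fun z : ℂ => z - (a + b * τ)) (𝓝[≠] (p + (a + b * τ))) (𝓝[≠] p) := by
    refine tendsto_nhdsWithin_of_tendsto_nhds_of_eventually_within _ ?_ ?_
    · have : Tendsto (fun z : ℂ => z - (a + b * τ)) (𝓝 (p + (a + b * τ)))
          (𝓝 (p + (a + b * τ) - (a + b * τ))) := (continuous_sub_right _).continuousAt
      rw [add_sub_cancel_right] at this
      exact this.mono_left nhdsWithin_le_nhds
    · filter_upwards [self_mem_nhdsWithin] with z hz
      intro h
      exact hz (by rw [Set.mem_singleton_iff] at h ⊢; rw [← h]; ring)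
  have := (hp.comp ht).const_mul (α ^ a * β ^ b)
  rw [mul_zero] at this
  refine this.congr fun z => ?_
  have hz := add_lattice_of_quasiPeriodic hα hβ h1 hτ a b (z - (a + b * τ))
  rw [sub_add_cancel] at hz
  rw [hz, Function.comp_apply]
  ring

theorem eventually_ne_zero_of_differentiable {f : ℂ → ℂ} (hf : Differentiable ℂ f)
    (hne : ∃ y, f y ≠ 0) (p : ℂ) : ∀ᶠ z in 𝓝[≠] p, f z ≠ 0 := by
  have han : AnalyticOnNhd ℂ f Set.univ := fun x _ => hf.analyticAt x
  rcases (hf.analyticAt p).eventually_eq_zero_or_eventually_ne_zero with h | h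
  · obtain ⟨y, hy⟩ := hne
    exact absurd (han.eqOn_zero_of_preconnected_of_eventuallyEq_zero isPreconnected_univ
      (Set.mem_univ p) h (Set.mem_univ y)) hy
  · exact h

/-- The quotient of `exp (πix) θ₁(x)` by the product is doubly periodic. Its only possible poles are
lattice points, where the simple zero of the product is met by a zero of θ₁, so it is constant. The
constant is not computed; it is nonzero as soon as θ₁ is nonzero somewhere. -/
theorem theta1_eq_const_mul_thetaProd {τ : ℂ} (hτ : 0 < τ.im) :
    ∃ C : ℂ, ∀ x, theta1 τ x = C * (exp (-(Real.pi * I * x)) * thetaProd τ x) := by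
  have hθ := differentiable_theta1 hτ
  have hT := differentiable_thetaProd hτ
  set F : ℂ → ℂ := fun x => exp (Real.pi * I * x) * theta1 τ x / thetaProd τ x with hF
  obtain ⟨c, hc, hder⟩ := exists_hasDerivAt_thetaProd_zero hτ
  have hTne : ∃ y, thetaProd τ y ≠ 0 := by
    by_contra! h
    have h0 : thetaProd τ = fun _ => 0 := funext h
    rw [h0] at hder
    exact hc (hder.unique (hasDerivAt_const _ _))
  have hT0 : thetaProd τ 0 = 0 := by
    have : qPochhammer (exp (2 * Real.pi * I * τ)) 1 = 0 := by
      rw [qPochhammer_eq_mul (norm_nome_lt_one hτ), sub_self, zero_mul]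
    simp [thetaProd, this]
  have h1 : ∀ x, F (x + 1) = 1 * F x := by
    intro x
    simp only [hF]
    rw [theta1_add_one, thetaProd_add_one, mul_add, exp_add, mul_one, exp_pi_mul_I]
    ring
  have h2 : ∀ x, F (x + τ) = 1 * F x := by
    intro x
    simp only [hF]
    rw [theta1_add_tau, thetaProd_add_tau hτ, mul_add, exp_add, one_mul]
    rw [show exp (Real.pi * I * x) * exp (Real.pi * I * τ) *
      (-exp (-(Real.pi * I * τ + 2 * Real.pi * I * x)) * theta1 τ x) =
      (-exp (-(2 * Real.pi * I * x))) * (exp (Real.pi * I * x) * theta1 τ x) by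
        rw [neg_add, exp_add, exp_neg (Real.pi * I * τ)]
        field_simp]
    exact mul_div_mul_left _ _ (neg_ne_zero.2 (exp_ne_zero _))
  have hmer : ∀ p, MeromorphicAt F p := fun p =>
    ((by fun_prop : AnalyticAt ℂ (fun x => exp (Real.pi * I * x)) p).mul
      (hθ.analyticAt p)).meromorphicAt.div (hT.analyticAt p).meromorphicAt
  have hslope : Tendsto (fun z => thetaProd τ z / z) (𝓝[≠] 0) (𝓝 c) := by
    have := hasDerivAt_iff_tendsto_slope.1 hder
    refine this.congr fun z => ?_
    simp [slope_def_field, hT0]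
  have hpole0 : Tendsto (fun z => (z - 0) * F z) (𝓝[≠] 0) (𝓝 0) := by
    have hnum : Tendsto (fun z => exp (Real.pi * I * z) * theta1 τ z) (𝓝[≠] 0) (𝓝 0) := by
      have : Continuous fun z => exp (Real.pi * I * z) * theta1 τ z :=
        (by fun_prop : Continuous fun z : ℂ => exp (Real.pi * I * z)).mul hθ.continuous
      have := this.tendsto 0
      simp only [theta1_zero, mul_zero] at this
      exact this.mono_left nhdsWithin_le_nhds
    have := hnum.div hslope hc
    rw [zero_div] at this
    refine this.congr fun z => ?_
    simp only [hF, Pi.div_apply, sub_zero, div_div_eq_mul_div]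
    ring
  have hpole : ∀ p, Tendsto (fun z => (z - p) * F z) (𝓝[≠] p) (𝓝 0) := by
    intro p
    by_cases hp : thetaProd τ p = 0
    · obtain ⟨a, b, rfl⟩ := exists_lattice_of_thetaProd_eq_zero hτ hp
      have := tendsto_sub_mul_add_lattice one_ne_zero one_ne_zero h1 h2 hpole0 a b
      simpa only [zero_add] using this
    · have hcont : ContinuousAt (fun z => (z - p) * F z) p :=
        (by fun_prop : ContinuousAt (fun z : ℂ => z - p) p).mul
          (((by fun_prop : ContinuousAt (fun z : ℂ => exp (Real.pi * I * z)) p).mul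
            hθ.continuous.continuousAt).div hT.continuous.continuousAt hp)
      have := hcont.tendsto
      rw [sub_self, zero_mul] at this
      exact this.mono_left nhdsWithin_le_nhds
  obtain ⟨h, hh, hhF⟩ := exists_entire_eventuallyEq hmer hpole
  obtain ⟨C, hC⟩ := const_of_doublyPeriodic hτ hh
    (fun x => by rw [quasiPeriodic_of_eventuallyEq hh.continuous hhF h1, one_mul])
    (fun x => by rw [quasiPeriodic_of_eventuallyEq hh.continuous hhF h2, one_mul])
  refine ⟨C, fun x => ?_⟩
  have hcont : Continuous fun z => C * (exp (-(Real.pi * I * z)) * thetaProd τ z) :=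
    continuous_const.mul ((by fun_prop : Continuous fun z : ℂ => exp (-(Real.pi * I * z))).mul
      hT.continuous)
  refine eq_of_eventuallyEq_punctured hθ.continuous.continuousAt hcont.continuousAt ?_
  filter_upwards [hhF x, eventually_ne_zero_of_differentiable hT hTne x] with z hz hTz
  rw [hC] at hz
  rw [hz, exp_neg]
  simp only [hF]
  field_simp

theorem theta1_eq_zero_iff {τ : ℂ} (hτ : 0 < τ.im) (hne : ∃ y, theta1 τ y ≠ 0) {x : ℂ} :
    theta1 τ x = 0 ↔ ∃ a b : ℤ, x = a + b * τ := by
  constructor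
  · intro hx
    obtain ⟨C, hC⟩ := theta1_eq_const_mul_thetaProd hτ
    have hC0 : C ≠ 0 := by
      rintro rfl
      obtain ⟨y, hy⟩ := hne
      exact hy (by rw [hC, zero_mul])
    rw [hC] at hx
    refine exists_lattice_of_thetaProd_eq_zero hτ ?_
    simpa [hC0, exp_ne_zero] using hx
  · rintro ⟨a, b, rfl⟩
    have key : ∀ n : ℤ, theta1 τ (n * τ) = 0 := by
      intro n
      induction n with
      | zero => simp
      | succ n ih =>
        rw [show ((n + 1 : ℤ) : ℂ) * τ = ((n : ℤ) : ℂ) * τ + τ by push_cast; ring,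
          theta1_add_tau, ih, mul_zero]
      | pred n ih =>
        rw [show ((-n : ℤ) : ℂ) * τ = ((-n - 1 : ℤ) : ℂ) * τ + τ by push_cast; ring,
          theta1_add_tau] at ih
        simpa [exp_ne_zero] using ih
    -- Only integer translation is needed, so the second period is the dummy 0.
    have := add_lattice_of_quasiPeriodic (F := theta1 τ) (α := -1) (β := 1) (τ := 0)
      (by norm_num) one_ne_zero (fun x => by rw [theta1_add_one]; ring) (by simp) a 0 (b * τ)
    rw [key, mul_zero] at this
    simpa [add_comm] using this

theorem exists_hasDerivAt_theta1_zero {τ : ℂ} (hτ : 0 < τ.im) (hne : ∃ y, theta1 τ y ≠ 0) :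
    ∃ c : ℂ, c ≠ 0 ∧ HasDerivAt (theta1 τ) c 0 := by
  obtain ⟨C, hC⟩ := theta1_eq_const_mul_thetaProd hτ
  have hC0 : C ≠ 0 := by
    rintro rfl
    obtain ⟨y, hy⟩ := hne
    exact hy (by rw [hC, zero_mul])
  have hT0 : thetaProd τ 0 = 0 := by
    have := hC 0
    simpa [hC0] using this
  obtain ⟨c, hc, hder⟩ := exists_hasDerivAt_thetaProd_zero hτ
  refine ⟨C * c, mul_ne_zero hC0 hc, ?_⟩
  rw [funext hC]
  have he : DifferentiableAt ℂ (fun x : ℂ => exp (-(Real.pi * I * x))) 0 := by fun_prop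
  have := (he.hasDerivAt.mul hder).const_mul C
  simpa [hT0] using this

end ThetaZeros

/-! ### The polynomials A_j: determinant, recurrence, degree. -/

section Recurrence

open Polynomial

theorem ellNum_neg (τ η : ℂ) (n : ℤ) : ellNum τ η (-n) = -ellNum τ η n := by
  rw [ellNum, ellNum, Int.cast_neg, neg_mul, theta1_neg, neg_div]

@[simp] theorem ellNum_zero (τ η : ℂ) : ellNum τ η 0 = 0 := by
  simp [ellNum]

theorem ellFact_succ (τ η : ℂ) (n : ℕ) :
    ellFact τ η (n + 1) = ellNum τ η (n + 1) * ellFact τ η n := by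
  rw [ellFact, ellFact, Finset.prod_Icc_succ_top (by omega), mul_comm]
  push_cast
  rfl

theorem ellFact_zero (τ η : ℂ) : ellFact τ η 0 = 1 := by
  simp [ellFact]

theorem ellNum_ne_zero {τ η : ℂ} {N : ℕ} (hη : ∀ j : ℕ, 1 ≤ j → j ≤ N → theta1 τ (j * η) ≠ 0)
    {n : ℕ} (h1 : 1 ≤ n) (h2 : n ≤ N) : ellNum τ η n ≠ 0 := by
  have := hη 1 le_rfl (h1.trans h2)
  rw [Nat.cast_one, one_mul] at this
  exact div_ne_zero (by simpa using hη n h1 h2) this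

theorem ellFact_ne_zero {τ η : ℂ} {N : ℕ} (hη : ∀ j : ℕ, 1 ≤ j → j ≤ N → theta1 τ (j * η) ≠ 0)
    {n : ℕ} (hn : n ≤ N) : ellFact τ η n ≠ 0 :=
  Finset.prod_ne_zero_iff.2 fun j hj => by
    rw [Finset.mem_Icc] at hj
    exact ellNum_ne_zero hη hj.1 (hj.2.trans hn)

/-- Expansion of a tridiagonal determinant along its last row. -/
theorem det_tridiagonal_succ {R : Type*} [CommRing R] (f : ℕ → ℕ → R)
    (h0 : ∀ i j, i + 1 < j → f i j = 0) (h1 : ∀ i j, j + 1 < i → f i j = 0) (s : ℕ) :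
    (Matrix.of fun a b : Fin (s + 2) => f a b).det =
      f (s + 1) (s + 1) * (Matrix.of fun a b : Fin (s + 1) => f a b).det -
        f (s + 1) s * f s (s + 1) * (Matrix.of fun a b : Fin s => f a b).det := by
  rw [Matrix.det_succ_row _ (Fin.last (s + 1)), Fin.sum_univ_castSucc, Fin.sum_univ_castSucc]
  rw [Finset.sum_eq_zero, zero_add]
  · have e1 : (Matrix.of fun a b : Fin (s + 2) => f a b).submatrix (Fin.last (s + 1)).succAbove
        (Fin.last (s + 1)).succAbove = Matrix.of fun a b : Fin (s + 1) => f a b := by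
      ext a b
      simp
    -- In the minor of the entry (s+1, s), the last column has the single possibly nonzero entry `f
    -- s (s + 1)`.
    have e2 : ((Matrix.of fun a b : Fin (s + 2) => f a b).submatrix (Fin.last (s + 1)).succAbove
        (Fin.last s).castSucc.succAbove).det =
          f s (s + 1) * (Matrix.of fun a b : Fin s => f a b).det := by
      rw [Matrix.det_succ_column _ (Fin.last s), Fin.sum_univ_castSucc, Finset.sum_eq_zero,
        zero_add]
      · have : ((Matrix.of fun a b : Fin (s + 2) => f a b).submatrix
            (Fin.last (s + 1)).succAbove (Fin.last s).castSucc.succAbove).submatrix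
            (Fin.last s).succAbove (Fin.last s).succAbove = Matrix.of fun a b : Fin s => f a b := by
          ext a b
          simp [Fin.succAbove_of_castSucc_lt, Fin.lt_def]
        rw [this]
        simp [← two_mul, Fin.succAbove]
      · intro i _
        have : f i (s + 1) = 0 := h0 _ _ (by have := i.isLt; omega)
        simp [Fin.succAbove, this]
    rw [e1, e2]
    simp only [Fin.val_last, Fin.val_castSucc, Matrix.of_apply, ← two_mul, pow_mul]
    have : (-1 : R) ^ (s + 1 + s) = -1 := by
      rw [show s + 1 + s = 2 * s + 1 by ring, pow_succ, pow_mul]; simp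
    rw [this]
    simp
    ring
  · intro i _
    have : f (s + 1) i = 0 := h1 _ _ (by have := i.isLt; omega)
    simp [this]

/-- The entries of `lameMatrix`, with indices in `ℕ`. -/
def lameEntry (τ η : ℂ) (ℓ : ℕ) (a b : ℕ) : ℂ[X] :=
  let i : ℤ := a + 1
  let j : ℤ := b + 1
  (if i = j then Polynomial.X else 0)
    + (if i = j - 1 then
        Polynomial.C (ellNum τ η (-i) / ellNum τ η (ℓ + 1 - i)) else 0)
    + (if i = j + 1 then
        Polynomial.C (ellNum τ η (2 * ℓ + 2 - i) / ellNum τ η (ℓ + 1 - i)) else 0)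

theorem lameMatrix_eq (τ η : ℂ) (ℓ s : ℕ) :
    lameMatrix τ η ℓ s = Matrix.of fun a b : Fin s => lameEntry τ η ℓ a b := rfl

theorem lameEntry_self (τ η : ℂ) (ℓ a : ℕ) : lameEntry τ η ℓ a a = X := by
  simp [lameEntry]

theorem lameEntry_succ_right (τ η : ℂ) (ℓ a : ℕ) :
    lameEntry τ η ℓ a (a + 1) = C (-ellNum τ η (a + 1) / ellNum τ η (ℓ - a)) := by
  rw [lameEntry, if_neg (by push_cast; omega), if_pos (by push_cast; omega),
    if_neg (by push_cast; omega), ellNum_neg]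
  simp only [zero_add, add_zero]
  rw [show (ℓ : ℤ) + 1 - (a + 1) = ℓ - a by ring]

theorem lameEntry_succ_left (τ η : ℂ) (ℓ a : ℕ) :
    lameEntry τ η ℓ (a + 1) a =
      C (ellNum τ η (2 * ℓ - a) / ellNum τ η (ℓ - (a + 1 : ℕ))) := by
  rw [lameEntry, if_neg (by push_cast; omega), if_neg (by push_cast; omega),
    if_pos (by push_cast; omega)]
  simp only [zero_add]
  push_cast
  rw [show (ℓ : ℤ) + 1 - (a + 1 + 1) = ℓ - (a + 1) by ring,
    show 2 * (ℓ : ℤ) + 2 - (a + 1 + 1) = 2 * ℓ - a by ring]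

theorem lameEntry_eq_zero (τ η : ℂ) (ℓ : ℕ) {a b : ℕ} (h : a + 1 < b ∨ b + 1 < a) :
    lameEntry τ η ℓ a b = 0 := by
  rw [lameEntry, if_neg (by omega), if_neg (by omega), if_neg (by omega)]
  simp

/-- The minus sign of the tridiagonal expansion is absorbed by [-i] = -[i]. -/
theorem det_lameMatrix_succ (τ η : ℂ) (ℓ s : ℕ) :
    (lameMatrix τ η ℓ (s + 2)).det = X * (lameMatrix τ η ℓ (s + 1)).det +
      C (ellNum τ η (2 * ℓ - s) * ellNum τ η (s + 1) /
        (ellNum τ η (ℓ - (s + 1 : ℕ)) * ellNum τ η (ℓ - s))) * (lameMatrix τ η ℓ s).det := by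
  rw [lameMatrix_eq, lameMatrix_eq, lameMatrix_eq,
    det_tridiagonal_succ _ (fun i j h => lameEntry_eq_zero τ η ℓ (Or.inl h))
      (fun i j h => lameEntry_eq_zero τ η ℓ (Or.inr h)),
    lameEntry_self, lameEntry_succ_left, lameEntry_succ_right, ← C_mul]
  rw [sub_eq_add_neg, neg_mul_eq_neg_mul, ← C_neg]
  congr 3
  ring

theorem ellBinom_ratio_succ {τ η : ℂ} {ℓ : ℕ}
    (hη : ∀ j : ℕ, 1 ≤ j → j ≤ 2 * ℓ → theta1 τ (j * η) ≠ 0) {s : ℕ} (hs : s + 1 ≤ ℓ) :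
    ellBinom τ η ℓ (s + 1) * (ellBinom τ η (2 * ℓ) (s + 1))⁻¹ =
      ellNum τ η (ℓ - s) / ellNum τ η (2 * ℓ - s) *
        (ellBinom τ η ℓ s * (ellBinom τ η (2 * ℓ) s)⁻¹) := by
  have hF : ∀ n, n ≤ 2 * ℓ → ellFact τ η n ≠ 0 := fun n hn => ellFact_ne_zero hη hn
  obtain ⟨k, rfl⟩ := Nat.exists_eq_add_of_le hs
  have e1 := ellFact_succ τ η k
  have e2 := ellFact_succ τ η (s + 1 + k + k)
  have n1 : ellNum τ η ((k : ℤ) + 1) ≠ 0 := by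
    exact_mod_cast ellNum_ne_zero hη (n := k + 1) (by omega) (by omega)
  have n2 : ellNum τ η ((s + 1 + k + k : ℕ) + 1 : ℤ) ≠ 0 := by
    exact_mod_cast ellNum_ne_zero hη (n := s + 1 + k + k + 1) (by omega) (by omega)
  simp only [ellBinom]
  rw [show s + 1 + k - s = k + 1 by omega, show s + 1 + k - (s + 1) = k by omega,
    show 2 * (s + 1 + k) - s = s + 1 + k + k + 1 by omega,
    show 2 * (s + 1 + k) - (s + 1) = s + 1 + k + k by omega,
    show ((s + 1 + k : ℕ) : ℤ) - s = k + 1 by push_cast; ring,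
    show 2 * ((s + 1 + k : ℕ) : ℤ) - s = (s + 1 + k + k : ℕ) + 1 by push_cast; ring, e1, e2]
  have h1 := hF k (by omega)
  have h2 := hF (s + 1 + k + k) (by omega)
  have h3 := hF (2 * (s + 1 + k)) (by omega)
  have h4 := hF s (by omega)
  have h5 := hF (s + 1) (by omega)
  field_simp

theorem lameA_self (τ η : ℂ) {ℓ : ℕ}
    (hη : ∀ j : ℕ, 1 ≤ j → j ≤ 2 * ℓ → theta1 τ (j * η) ≠ 0) : lameA τ η ℓ ℓ = 1 := by
  have h1 : ellFact τ η ℓ ≠ 0 := ellFact_ne_zero hη (by omega)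
  have h2 : ellFact τ η (2 * ℓ) ≠ 0 := ellFact_ne_zero hη le_rfl
  rw [lameA, Nat.sub_self]
  simp [ellBinom, ellFact_zero, h1, h2]

theorem lameA_pred (τ η : ℂ) {ℓ : ℕ} (hℓ : 1 ≤ ℓ)
    (hη : ∀ j : ℕ, 1 ≤ j → j ≤ 2 * ℓ → theta1 τ (j * η) ≠ 0) :
    lameA τ η ℓ (ℓ - 1) = C (ellNum τ η ℓ / ellNum τ η (2 * ℓ)) * X := by
  have h1 : ellFact τ η ℓ ≠ 0 := ellFact_ne_zero hη (by omega)
  have h2 : ellFact τ η (2 * ℓ) ≠ 0 := ellFact_ne_zero hη le_rfl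
  have hr := ellBinom_ratio_succ hη (s := 0) hℓ
  have hd : (lameMatrix τ η ℓ 1).det = X := by
    rw [lameMatrix_eq, Matrix.det_fin_one]
    exact lameEntry_self τ η ℓ 0
  rw [lameA, show ℓ - (ℓ - 1) = 0 + 1 by omega, hr, zero_add, hd]
  simp [ellBinom, ellFact_zero, h1, h2]

/-- Two steps of the normalising ratio `ellBinom_ratio_succ` cancel the denominators of the product
of off-diagonal entries. -/
theorem lameA_recurrence {τ η : ℂ} {ℓ : ℕ}
    (hη : ∀ j : ℕ, 1 ≤ j → j ≤ 2 * ℓ → theta1 τ (j * η) ≠ 0) {s : ℕ} (hs1 : 1 ≤ s)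
    (hs : s + 1 ≤ ℓ) :
    lameA τ η ℓ (ℓ - s - 1) =
      C (ellNum τ η (ℓ - s) / ellNum τ η (2 * ℓ - s)) * X * lameA τ η ℓ (ℓ - s)
        + C (ellNum τ η s / ellNum τ η (2 * ℓ - s)) * lameA τ η ℓ (ℓ - s + 1) := by
  obtain ⟨s, rfl⟩ := Nat.exists_eq_add_of_le' hs1
  have r1 := ellBinom_ratio_succ hη (s := s) (by omega)
  have r2 := ellBinom_ratio_succ hη (s := s + 1) (by omega)
  rw [lameA, lameA, lameA, show ℓ - (ℓ - (s + 1) - 1) = s + 2 by omega,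
    show ℓ - (ℓ - (s + 1)) = s + 1 by omega, show ℓ - (ℓ - (s + 1) + 1) = s by omega,
    det_lameMatrix_succ, r2, r1]
  have hn : ∀ n : ℤ, 1 ≤ n → n ≤ 2 * ℓ → ellNum τ η n ≠ 0 := by
    intro n h1 h2
    lift n to ℕ using by omega
    exact ellNum_ne_zero hη (by omega) (by omega)
  have n1 := hn (ℓ - (s + 1 : ℕ)) (by push_cast; omega) (by push_cast; omega)
  have n2 := hn (ℓ - s) (by omega) (by omega)
  have n3 := hn (2 * ℓ - s) (by omega) (by omega)
  rw [mul_add, ← mul_assoc (C _) (C _) (lameMatrix τ η ℓ s).det, ← C_mul,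
    ← mul_assoc (C _) (C _) (lameMatrix τ η ℓ s).det, ← C_mul]
  congr 1
  · simp only [C_mul]
    ring
  · congr 2
    push_cast at n1 ⊢
    field_simp

/-- A three-term recurrence needs two consecutive degrees as induction hypothesis; genericity keeps
the coefficient of E nonzero. -/
theorem degree_lameA_and {τ η : ℂ} {ℓ : ℕ} (hℓ : 1 ≤ ℓ)
    (hη : ∀ j : ℕ, 1 ≤ j → j ≤ 2 * ℓ → theta1 τ (j * η) ≠ 0) :
    ∀ s : ℕ, s + 1 ≤ ℓ → (lameA τ η ℓ (ℓ - s)).degree = (s : ℕ) ∧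
      (lameA τ η ℓ (ℓ - (s + 1))).degree = (s + 1 : ℕ) := by
  have hn : ∀ n : ℤ, 1 ≤ n → n ≤ 2 * ℓ → ellNum τ η n ≠ 0 := by
    intro n h1 h2
    lift n to ℕ using by omega
    exact ellNum_ne_zero hη (by omega) (by omega)
  intro s
  induction s with
  | zero =>
    intro _
    rw [Nat.sub_zero, zero_add, lameA_self τ η hη, lameA_pred τ η hℓ hη, degree_one,
      degree_C_mul_X (div_ne_zero (hn _ (by omega) (by omega)) (hn _ (by omega) (by omega)))]
    simp
  | succ s ih =>
    intro hs
    obtain ⟨h1, h2⟩ := ih (by omega)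
    refine ⟨h2, ?_⟩
    have hc := div_ne_zero (hn (ℓ - (s + 1 : ℕ)) (by push_cast; omega) (by push_cast; omega))
      (hn (2 * ℓ - (s + 1 : ℕ)) (by push_cast; omega) (by push_cast; omega))
    have hlead : (C (ellNum τ η (ℓ - (s + 1 : ℕ)) / ellNum τ η (2 * ℓ - (s + 1 : ℕ))) * X *
        lameA τ η ℓ (ℓ - (s + 1))).degree = ((s + 1 + 1 : ℕ) : WithBot ℕ) := by
      rw [degree_mul, degree_C_mul_X hc, h2]
      push_cast
      ring
    have hlow : (C (ellNum τ η (s + 1 : ℕ) / ellNum τ η (2 * ℓ - (s + 1 : ℕ))) *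
        lameA τ η ℓ (ℓ - (s + 1) + 1)).degree <
          ((s + 1 + 1 : ℕ) : WithBot ℕ) := by
      rw [show ℓ - (s + 1) + 1 = ℓ - s by omega, degree_C_mul (div_ne_zero
        (hn (s + 1 : ℕ) (by push_cast; omega) (by push_cast; omega))
        (hn (2 * ℓ - (s + 1 : ℕ)) (by push_cast; omega) (by push_cast; omega))), h1]
      exact_mod_cast (by omega : s < s + 1 + 1)
    rw [← Nat.sub_sub _ (s + 1), lameA_recurrence hη (by omega) hs,
      degree_add_eq_left_of_degree_lt (by rw [hlead]; exact hlow), hlead]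

theorem degree_lameA {τ η : ℂ} {ℓ : ℕ} (hℓ : 1 ≤ ℓ)
    (hη : ∀ j : ℕ, 1 ≤ j → j ≤ 2 * ℓ → theta1 τ (j * η) ≠ 0) {j : ℕ} (hj : j ≤ ℓ) :
    (lameA τ η ℓ j).degree = ((ℓ - j : ℕ) : WithBot ℕ) := by
  rcases hj.eq_or_lt with rfl | hlt
  · rw [lameA_self τ η hη, Nat.sub_self, degree_one]
    simp
  · have := (degree_lameA_and hℓ hη (ℓ - j - 1) (by omega)).2
    rwa [show ℓ - j - 1 + 1 = ℓ - j by omega, show ℓ - (ℓ - j) = j by omega] at this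

theorem satisfiesRecurrence_lameA {τ η : ℂ} {ℓ : ℕ} (hℓ : 1 ≤ ℓ)
    (hη : ∀ j : ℕ, 1 ≤ j → j ≤ 2 * ℓ → theta1 τ (j * η) ≠ 0) :
    SatisfiesRecurrence τ η ℓ (lameA τ η ℓ) :=
  ⟨lameA_self τ η hη, lameA_pred τ η hℓ hη, fun _ hs1 hs => lameA_recurrence hη hs1 hs⟩

theorem eq_of_satisfiesRecurrence {τ η : ℂ} {ℓ : ℕ} {P Q : ℕ → ℂ[X]}
    (hP : SatisfiesRecurrence τ η ℓ P) (hQ : SatisfiesRecurrence τ η ℓ Q) {j : ℕ} (hj : j ≤ ℓ) :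
    P j = Q j := by
  have key : ∀ s : ℕ, P (ℓ - s) = Q (ℓ - s) ∧ (s + 1 ≤ ℓ → P (ℓ - s - 1) = Q (ℓ - s - 1)) := by
    intro s
    induction s with
    | zero =>
      refine ⟨?_, fun _ => ?_⟩
      · rw [Nat.sub_zero, hP.1, hQ.1]
      · rw [Nat.sub_zero, hP.2.1, hQ.2.1]
    | succ s ih =>
      have h1 : P (ℓ - (s + 1)) = Q (ℓ - (s + 1)) := by
        by_cases hs : s + 1 ≤ ℓ
        · rw [← Nat.sub_sub]
          exact ih.2 hs
        -- Past s = ℓ, truncated subtraction makes both indices 0.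
        · rw [show ℓ - (s + 1) = ℓ - s by omega]
          exact ih.1
      refine ⟨h1, fun hs => ?_⟩
      rw [hP.2.2 (s + 1) (by omega) hs, hQ.2.2 (s + 1) (by omega) hs, h1,
        show ℓ - (s + 1) + 1 = ℓ - s by omega, ih.1]
  have := (key (ℓ - j)).1
  rwa [show ℓ - (ℓ - j) = j by omega] at this

theorem satisfiesRecurrence_congr {τ η : ℂ} {ℓ : ℕ} {P Q : ℕ → ℂ[X]}
    (hP : SatisfiesRecurrence τ η ℓ P) (h : ∀ j ≤ ℓ, Q j = P j) : SatisfiesRecurrence τ η ℓ Q := by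
  refine ⟨?_, ?_, fun s hs1 hs => ?_⟩
  · rw [h _ le_rfl, hP.1]
  · rw [h _ (by omega), hP.2.1]
  · rw [h _ (by omega), h _ (by omega), h _ (by omega), hP.2.2 s hs1 hs]

end Recurrence

/-! ### The Lamé equation as a system of residue conditions. -/

section Residues

open Complex Filter Topology

theorem Phi_add_one (τ x ζ : ℂ) : Phi τ (x + 1) ζ = Phi τ x ζ := by
  rw [Phi, Phi, ← add_assoc, theta1_add_one, theta1_add_one, neg_mul, neg_div_neg_eq]

theorem Phi_add_tau (τ x ζ : ℂ) :
    Phi τ (x + τ) ζ = exp (-(2 * Real.pi * I * ζ)) * Phi τ x ζ := by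
  have h : -exp (-(Real.pi * I * τ + 2 * Real.pi * I * (ζ + x))) =
      -exp (-(Real.pi * I * τ + 2 * Real.pi * I * x)) * exp (-(2 * Real.pi * I * ζ)) := by
    rw [neg_mul, ← exp_add]
    congr 2
    ring
  rw [Phi, Phi, ← add_assoc, theta1_add_tau, theta1_add_tau, h, mul_assoc,
    mul_assoc (-exp _) (theta1 τ x), mul_div_mul_left _ _ (neg_ne_zero.2 (exp_ne_zero _)),
    mul_div_assoc]

theorem lameCoeff_add_one (τ η : ℂ) (ℓ : ℕ) (x : ℂ) :
    lameCoeff τ η ℓ (x + 1) = lameCoeff τ η ℓ x := by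
  rw [lameCoeff, lameCoeff, add_right_comm, add_sub_right_comm, add_sub_right_comm]
  simp only [theta1_add_one, neg_mul_neg]

/-- The arguments of the two theta factors have the same sum in numerator and denominator, so the
exponential factors cancel. -/
theorem lameCoeff_add_tau (τ η : ℂ) (ℓ : ℕ) (x : ℂ) :
    lameCoeff τ η ℓ (x + τ) = lameCoeff τ η ℓ x := by
  rw [lameCoeff, lameCoeff, add_right_comm, add_sub_right_comm, add_sub_right_comm]
  simp only [theta1_add_tau]
  have h : (-exp (-(Real.pi * I * τ + 2 * Real.pi * I * (x + ℓ * η)))) *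
      (-exp (-(Real.pi * I * τ + 2 * Real.pi * I * (x - (ℓ + 1) * η)))) =
      (-exp (-(Real.pi * I * τ + 2 * Real.pi * I * x))) *
      (-exp (-(Real.pi * I * τ + 2 * Real.pi * I * (x - η)))) := by
    rw [neg_mul_neg, neg_mul_neg, ← exp_add, ← exp_add]
    congr 1
    ring
  rw [mul_mul_mul_comm, h, mul_mul_mul_comm (-exp _) (theta1 τ x), mul_div_mul_left]
  exact mul_ne_zero (neg_ne_zero.2 (exp_ne_zero _)) (neg_ne_zero.2 (exp_ne_zero _))

/-- The sum `∑_{j=1}^ℓ s_j Φ(x - jη, ζ)`. -/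
def phiSum (τ η : ℂ) (ℓ : ℕ) (ζ : ℂ) (s : ℕ → ℂ) (x : ℂ) : ℂ :=
  ∑ j ∈ Finset.Icc 1 ℓ, s j * Phi τ (x - j * η) ζ

theorem phiSum_add_one (τ η : ℂ) (ℓ : ℕ) (ζ : ℂ) (s : ℕ → ℂ) (x : ℂ) :
    phiSum τ η ℓ ζ s (x + 1) = phiSum τ η ℓ ζ s x :=
  Finset.sum_congr rfl fun j _ => by rw [add_sub_right_comm, Phi_add_one]

theorem phiSum_add_tau (τ η : ℂ) (ℓ : ℕ) (ζ : ℂ) (s : ℕ → ℂ) (x : ℂ) :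
    phiSum τ η ℓ ζ s (x + τ) = exp (-(2 * Real.pi * I * ζ)) * phiSum τ η ℓ ζ s x := by
  rw [phiSum, phiSum, Finset.mul_sum]
  exact Finset.sum_congr rfl fun j _ => by rw [add_sub_right_comm, Phi_add_tau]; ring

theorem ansatz_eq (τ η : ℂ) (ℓ : ℕ) (κ ζ : ℂ) (s : ℕ → ℂ) (x : ℂ) :
    ansatz τ η ℓ κ ζ s x = exp (κ * x / η) * phiSum τ η ℓ ζ s x := rfl

theorem isDoubleBloch_ansatz (τ η : ℂ) (ℓ : ℕ) (κ ζ : ℂ) (s : ℕ → ℂ) :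
    IsDoubleBloch τ (exp (κ / η)) (exp (κ * τ / η) * exp (-(2 * Real.pi * I * ζ)))
      (ansatz τ η ℓ κ ζ s) := by
  intro x
  simp only [ansatz_eq, phiSum_add_one, phiSum_add_tau, mul_add, add_div, exp_add, mul_one]
  constructor <;> ring

/-- The difference of the two sides of the equation, divided by `K^{x/η}`. -/
def lameDefect (τ η : ℂ) (ℓ : ℕ) (ζ K E : ℂ) (s : ℕ → ℂ) (x : ℂ) : ℂ :=
  K * phiSum τ η ℓ ζ s (x + η) + lameCoeff τ η ℓ x * (K⁻¹ * phiSum τ η ℓ ζ s (x - η)) -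
    E * phiSum τ η ℓ ζ s x

theorem lameDefect_add_one (τ η : ℂ) (ℓ : ℕ) (ζ K E : ℂ) (s : ℕ → ℂ) (x : ℂ) :
    lameDefect τ η ℓ ζ K E s (x + 1) = 1 * lameDefect τ η ℓ ζ K E s x := by
  simp only [lameDefect, add_right_comm x 1 η, add_sub_right_comm x 1 η, phiSum_add_one,
    lameCoeff_add_one, one_mul]

theorem lameDefect_add_tau (τ η : ℂ) (ℓ : ℕ) (ζ K E : ℂ) (s : ℕ → ℂ) (x : ℂ) :
    lameDefect τ η ℓ ζ K E s (x + τ) =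
      exp (-(2 * Real.pi * I * ζ)) * lameDefect τ η ℓ ζ K E s x := by
  simp only [lameDefect, add_right_comm x τ η, add_sub_right_comm x τ η, phiSum_add_tau,
    lameCoeff_add_tau]
  ring

theorem solvesLame_ansatz_iff {τ η : ℂ} (hη0 : η ≠ 0) (ℓ : ℕ) (ζ κ E : ℂ) (s : ℕ → ℂ) :
    SolvesLame τ η ℓ E (ansatz τ η ℓ κ ζ s) ↔
      ∀ x, IsRegularPoint τ η ℓ x → lameDefect τ η ℓ ζ (exp κ) E s x = 0 := by
  refine forall₂_congr fun x _ => ?_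
  have h : ansatz τ η ℓ κ ζ s (x + η) +
      lameCoeff τ η ℓ x * ansatz τ η ℓ κ ζ s (x - η) - E * ansatz τ η ℓ κ ζ s x =
      exp (κ * x / η) * lameDefect τ η ℓ ζ (exp κ) E s x := by
    have e1 : κ * (x + η) / η = κ * x / η + κ := by field_simp
    have e2 : κ * (x - η) / η = κ * x / η + -κ := by field_simp; ring
    simp only [ansatz_eq, lameDefect, e1, e2, exp_add, exp_neg]
    ring
  rw [← sub_eq_zero, h, mul_eq_zero, or_iff_right (exp_ne_zero _)]

theorem theta1_int_mul_ne_zero {τ η : ℂ} {N : ℕ}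
    (hη : ∀ j : ℕ, 1 ≤ j → j ≤ N → theta1 τ (j * η) ≠ 0) {n : ℤ} (h0 : n ≠ 0)
    (h1 : n.natAbs ≤ N) : theta1 τ (n * η) ≠ 0 := by
  have h := hη n.natAbs (by omega) h1
  rcases Int.natAbs_eq n with hn | hn
  · rwa [hn, Int.cast_natCast]
  · rwa [hn, Int.cast_neg, Int.cast_natCast, neg_mul, theta1_neg, neg_ne_zero]

theorem tendsto_of_continuousAt_punctured {f : ℂ → ℂ} {p : ℂ} (h : ContinuousAt f p) :
    Tendsto f (𝓝[≠] p) (𝓝 (f p)) :=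
  h.tendsto.mono_left nhdsWithin_le_nhds

section Limits

variable {τ η ζ : ℂ} {ℓ : ℕ}

theorem continuousAt_theta1_comp (hτ : 0 < τ.im) {g : ℂ → ℂ} {p : ℂ} (hg : ContinuousAt g p) :
    ContinuousAt (fun x => theta1 τ (g x)) p :=
  (differentiable_theta1 hτ).continuous.continuousAt.comp hg

theorem continuousAt_lameCoeff (hτ : 0 < τ.im) {p : ℂ} (h0 : theta1 τ p ≠ 0)
    (h1 : theta1 τ (p - η) ≠ 0) : ContinuousAt (lameCoeff τ η ℓ) p := by
  have c1 : ContinuousAt (fun x => theta1 τ (x + ℓ * η)) p :=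
    continuousAt_theta1_comp hτ (by fun_prop)
  have c2 : ContinuousAt (fun x => theta1 τ (x - (ℓ + 1) * η)) p :=
    continuousAt_theta1_comp hτ (by fun_prop)
  have c3 : ContinuousAt (fun x => theta1 τ (x - η)) p :=
    continuousAt_theta1_comp hτ (by fun_prop)
  have c4 : ContinuousAt (theta1 τ) p := continuousAt_theta1_comp hτ continuousAt_id
  exact ContinuousAt.div (c1.fun_mul c2) (c4.fun_mul c3) (mul_ne_zero h0 h1)

theorem eventually_theta1_sub_ne_zero (hτ : 0 < τ.im) (hne : ∃ y, theta1 τ y ≠ 0) (a p : ℂ) :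
    ∀ᶠ x in 𝓝[≠] p, theta1 τ (x - a) ≠ 0 := by
  obtain ⟨y, hy⟩ := hne
  refine eventually_ne_zero_of_differentiable (f := fun x => theta1 τ (x - a))
    ((differentiable_theta1 hτ).comp (by fun_prop)) ⟨y + a, by simpa using hy⟩ p

theorem eventually_isRegularPoint (hτ : 0 < τ.im) (hne : ∃ y, theta1 τ y ≠ 0) (η : ℂ) (ℓ : ℕ)
    (p : ℂ) : ∀ᶠ x in 𝓝[≠] p, IsRegularPoint τ η ℓ x := by
  have := (Filter.eventually_all_finset (Finset.range (ℓ + 2))).2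
    fun j _ => eventually_theta1_sub_ne_zero hτ hne ((j : ℂ) * η) p
  filter_upwards [this] with x hx j hj
  exact hx j (Finset.mem_range.2 (by omega))

theorem continuousAt_phiSum (hτ : 0 < τ.im) (hζ : theta1 τ ζ ≠ 0) (s : ℕ → ℂ) {g : ℂ → ℂ} {p : ℂ}
    (hg : ContinuousAt g p) (hp : ∀ j ∈ Finset.Icc 1 ℓ, theta1 τ (g p - j * η) ≠ 0) :
    ContinuousAt (fun x => phiSum τ η ℓ ζ s (g x)) p := by
  unfold phiSum Phi
  refine tendsto_finsetSum _ fun j hj => ContinuousAt.tendsto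
    (f := fun x => s j * (theta1 τ (ζ + (g x - j * η)) / (theta1 τ (g x - j * η) * theta1 τ ζ))) ?_
  refine continuousAt_const.mul (ContinuousAt.div ?_ ?_ (mul_ne_zero (hp j hj) hζ))
  · exact continuousAt_theta1_comp hτ (by fun_prop)
  · exact (continuousAt_theta1_comp hτ (by fun_prop)).mul continuousAt_const

/-- Multiplying by θ₁(x - mη) rather than x - mη makes the limit s_k itself, without θ₁'(0). The
terms j ≠ k are regular since 0 < |k - j| ≤ ℓ + 1 ≤ 2ℓ. Extending s by zero makes the statement
uniform in k. -/
theorem tendsto_theta1_mul_phiSum (hτ : 0 < τ.im)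
    (hη : ∀ j : ℕ, 1 ≤ j → j ≤ 2 * ℓ → theta1 τ (j * η) ≠ 0) (hζ : theta1 τ ζ ≠ 0)
    {s : ℕ → ℂ} (hs : ∀ j ∉ Finset.Icc 1 ℓ, s j = 0) {m : ℕ} {a : ℤ} {k : ℕ} (hk : m + a = k)
    (hkℓ : k ≤ ℓ + 2) (hℓ : 1 ≤ ℓ) :
    Tendsto (fun x => theta1 τ (x - m * η) * phiSum τ η ℓ ζ s (x + a * η)) (𝓝[≠] (m * η))
      (𝓝 (s k)) := by
  have hsum : s k = ∑ j ∈ Finset.Icc 1 ℓ, if k = j then s j else 0 := by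
    rw [Finset.sum_ite_eq]
    split_ifs with h
    · rfl
    · exact hs k h
  have hkC : (m : ℂ) + a = k := by exact_mod_cast hk
  rw [hsum]
  simp only [phiSum, Finset.mul_sum]
  refine tendsto_finsetSum _ fun j hj => ?_
  rw [Finset.mem_Icc] at hj
  split_ifs with h
  · subst h
    have hc : ContinuousAt (fun x => s k * (theta1 τ (ζ + (x - m * η)) / theta1 τ ζ)) (m * η) :=
      continuousAt_const.mul ((continuousAt_theta1_comp hτ (by fun_prop)).div_const _)
    have ht := tendsto_of_continuousAt_punctured hc
    simp only [sub_self, add_zero, div_self hζ, mul_one] at ht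
    refine ht.congr' ?_
    filter_upwards [eventually_theta1_sub_ne_zero hτ ⟨ζ, hζ⟩ ((m : ℂ) * η) (m * η)] with x hx
    rw [Phi, show x + a * η - k * η = x - m * η by rw [← hkC]; ring]
    field_simp
  · have hne : theta1 τ ((m : ℂ) * η + a * η - j * η) ≠ 0 := by
      have := theta1_int_mul_ne_zero hη (n := (k : ℤ) - j) (by omega) (by omega)
      rw [show (m : ℂ) * η + a * η - j * η = (((k : ℤ) - j : ℤ) : ℂ) * η by
        push_cast; rw [← hkC]; ring]
      exact this
    have hc : ContinuousAt (fun x => theta1 τ (x - m * η) *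
        (s j * Phi τ (x + a * η - j * η) ζ)) (m * η) := by
      unfold Phi
      refine (continuousAt_theta1_comp hτ (by fun_prop)).mul (continuousAt_const.mul
        (ContinuousAt.div ?_ ?_ (mul_ne_zero hne hζ)))
      · exact continuousAt_theta1_comp hτ (by fun_prop)
      · exact (continuousAt_theta1_comp hτ (by fun_prop)).mul continuousAt_const
    have ht := tendsto_of_continuousAt_punctured hc
    simpa using ht

/-- The residues of `lameDefect` at the points `mη`, up to a common factor. -/
def lameResidue (τ η : ℂ) (ℓ : ℕ) (ζ K E : ℂ) (s : ℕ → ℂ) : ℕ → ℂ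
  | 0 => K * s 1 + theta1 τ (ℓ * η) * theta1 τ (-((ℓ + 1) * η)) / theta1 τ (-η) *
      (K⁻¹ * phiSum τ η ℓ ζ s (-η))
  | 1 => K * s 2 + theta1 τ (η + ℓ * η) * theta1 τ (-(ℓ * η)) / theta1 τ η *
      (K⁻¹ * phiSum τ η ℓ ζ s 0) - E * s 1
  | m + 2 => K * s (m + 3) + lameCoeff τ η ℓ ((m + 2 : ℕ) * η) * (K⁻¹ * s (m + 1)) - E * s (m + 2)

/-- Only the middle term depends on the case. At 0 and η the pole comes from the coefficient, while
the shifted sum is regular; from 2η on the coefficient is regular and the sum contributes s_{m-1}.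
-/
theorem tendsto_theta1_mul_lameDefect (hτ : 0 < τ.im) (hℓ : 1 ≤ ℓ)
    (hη : ∀ j : ℕ, 1 ≤ j → j ≤ 2 * ℓ → theta1 τ (j * η) ≠ 0) (hζ : theta1 τ ζ ≠ 0) (K E : ℂ)
    {s : ℕ → ℂ} (hs : ∀ j ∉ Finset.Icc 1 ℓ, s j = 0) {m : ℕ} (hm : m ≤ ℓ + 1) :
    Tendsto (fun x => theta1 τ (x - m * η) * lameDefect τ η ℓ ζ K E s x) (𝓝[≠] (m * η))
      (𝓝 (lameResidue τ η ℓ ζ K E s m)) := by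
  have h1 := (tendsto_theta1_mul_phiSum hτ hη hζ hs (m := m) (a := 1) (k := m + 1)
    (by push_cast; ring) (by omega) hℓ).const_mul K
  have h0 := (tendsto_theta1_mul_phiSum hτ hη hζ hs (m := m) (a := 0) (k := m)
    (by ring) (by omega) hℓ).const_mul E
  simp only [Int.cast_one, one_mul, Int.cast_zero, zero_mul, add_zero] at h1 h0
  have hη1 : theta1 τ η ≠ 0 := by simpa using hη 1 le_rfl (by omega)
  suffices hmid : ∀ L : ℂ, Tendsto (fun x => theta1 τ (x - m * η) * (lameCoeff τ η ℓ x *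
      (K⁻¹ * phiSum τ η ℓ ζ s (x - η)))) (𝓝[≠] (m * η)) (𝓝 L) →
      Tendsto (fun x => theta1 τ (x - m * η) * lameDefect τ η ℓ ζ K E s x) (𝓝[≠] (m * η))
        (𝓝 (K * s (m + 1) + L - E * s m)) by
    match m, hm with
    | 0, _ =>
      have hc : ContinuousAt (fun x => theta1 τ (x + ℓ * η) * theta1 τ (x - (ℓ + 1) * η) /
          theta1 τ (x - η) * (K⁻¹ * phiSum τ η ℓ ζ s (x - η))) 0 := by
        refine ContinuousAt.mul (ContinuousAt.div ((continuousAt_theta1_comp hτ (by fun_prop)).mul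
          (continuousAt_theta1_comp hτ (by fun_prop))) (continuousAt_theta1_comp hτ (by fun_prop))
          (by rwa [zero_sub, theta1_neg, neg_ne_zero])) (continuousAt_const.mul
          (continuousAt_phiSum hτ hζ s (by fun_prop) fun j hj => ?_))
        rw [Finset.mem_Icc] at hj
        have := theta1_int_mul_ne_zero hη (n := -(j + 1 : ℤ)) (by omega) (by omega)
        rw [show (0 : ℂ) - η - j * η = ((-(j + 1 : ℤ) : ℤ) : ℂ) * η by push_cast; ring]
        exact this
      have ht := tendsto_of_continuousAt_punctured hc
      simp only [zero_add, zero_sub] at ht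
      have hd := hmid _ (by
        simp only [Nat.cast_zero, zero_mul, sub_zero]
        refine ht.congr' ?_
        filter_upwards [eventually_theta1_sub_ne_zero hτ ⟨ζ, hζ⟩ 0 0] with x hx
        rw [sub_zero] at hx
        rw [lameCoeff]
        field_simp)
      simpa [lameResidue, hs 0 (by simp)] using hd
    | 1, _ =>
      have hc : ContinuousAt (fun x => theta1 τ (x + ℓ * η) * theta1 τ (x - (ℓ + 1) * η) /
          theta1 τ x * (K⁻¹ * phiSum τ η ℓ ζ s (x - η))) η := by
        refine ContinuousAt.mul (ContinuousAt.div ((continuousAt_theta1_comp hτ (by fun_prop)).mul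
          (continuousAt_theta1_comp hτ (by fun_prop)))
          (continuousAt_theta1_comp hτ continuousAt_id) hη1)
          (continuousAt_const.mul
          (continuousAt_phiSum hτ hζ s (by fun_prop) fun j hj => ?_))
        rw [Finset.mem_Icc] at hj
        have := theta1_int_mul_ne_zero hη (n := -(j : ℤ)) (by omega) (by omega)
        rw [show η - η - j * η = ((-(j : ℤ) : ℤ) : ℂ) * η by push_cast; ring]
        exact this
      have ht := tendsto_of_continuousAt_punctured hc
      simp only [show η - (ℓ + 1) * η = -(ℓ * η) by ring, sub_self] at ht
      have hd := hmid _ (by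
        simp only [Nat.cast_one, one_mul]
        refine ht.congr' ?_
        filter_upwards [eventually_theta1_sub_ne_zero hτ ⟨ζ, hζ⟩ 0 η,
          eventually_theta1_sub_ne_zero hτ ⟨ζ, hζ⟩ η η] with x hx hx'
        rw [sub_zero] at hx
        rw [lameCoeff]
        field_simp)
      simpa [lameResidue] using hd
    | m + 2, hm =>
      have hp := tendsto_theta1_mul_phiSum hτ hη hζ hs (m := m + 2) (a := -1) (k := m + 1)
        (by push_cast; ring) (by omega) hℓ
      have hc : ContinuousAt (fun x => lameCoeff τ η ℓ x * K⁻¹) ((m + 2 : ℕ) * η) := by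
        refine (continuousAt_lameCoeff hτ (hη (m + 2) (by omega) (by omega)) ?_).fun_mul
          continuousAt_const
        rw [show ((m + 2 : ℕ) : ℂ) * η - η = (m + 1 : ℕ) * η by push_cast; ring]
        exact hη (m + 1) (by omega) (by omega)
      have hd := hmid _ (((tendsto_of_continuousAt_punctured hc).mul hp).congr fun x => by
        rw [Int.cast_neg, Int.cast_one, neg_one_mul, ← sub_eq_add_neg]
        ring)
      rw [mul_assoc] at hd
      exact hd
  intro L hL
  refine ((h1.add hL).sub h0).congr fun x => ?_
  rw [lameDefect]
  ring

/-- The factor θ₁(x - (ℓ+1)η) of the coefficient cancels the last pole of ψ(x - η). -/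
theorem lameResidue_add_one_eq_zero (hℓ : 1 ≤ ℓ) (K E : ℂ) {s : ℕ → ℂ}
    (hs : ∀ j ∉ Finset.Icc 1 ℓ, s j = 0) : lameResidue τ η ℓ ζ K E s (ℓ + 1) = 0 := by
  obtain ⟨n, rfl⟩ := Nat.exists_eq_add_of_le' hℓ
  rw [lameResidue, hs (n + 3) (by simp), hs (n + 2) (by simp), lameCoeff,
    show ((n + 2 : ℕ) : ℂ) * η - ((n + 1 : ℕ) + 1) * η = 0 by push_cast; ring, theta1_zero]
  simp

theorem continuousAt_lameDefect (hτ : 0 < τ.im) (hζ : theta1 τ ζ ≠ 0) (K E : ℂ) (s : ℕ → ℂ)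
    {p : ℂ} (hp : IsRegularPoint τ η ℓ p) : ContinuousAt (lameDefect τ η ℓ ζ K E s) p := by
  have hp0 : theta1 τ p ≠ 0 := by simpa using hp 0 (by omega)
  have hp1 : theta1 τ (p - η) ≠ 0 := by simpa using hp 1 (by omega)
  have c1 : ContinuousAt (fun x => phiSum τ η ℓ ζ s (x + η)) p := by
    refine continuousAt_phiSum hτ hζ s (by fun_prop) fun j hj => ?_
    rw [Finset.mem_Icc] at hj
    obtain ⟨i, rfl⟩ := Nat.exists_eq_add_of_le' hj.1
    rw [show p + η - (i + 1 : ℕ) * η = p - i * η by push_cast; ring]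
    exact hp i (by omega)
  have c2 : ContinuousAt (fun x => phiSum τ η ℓ ζ s (x - η)) p := by
    refine continuousAt_phiSum hτ hζ s (by fun_prop) fun j hj => ?_
    rw [Finset.mem_Icc] at hj
    rw [show p - η - j * η = p - (j + 1 : ℕ) * η by push_cast; ring]
    exact hp (j + 1) (by omega)
  have c3 : ContinuousAt (phiSum τ η ℓ ζ s) p := by
    refine continuousAt_phiSum hτ hζ s (g := fun x => x) (by fun_prop) fun j hj => ?_
    rw [Finset.mem_Icc] at hj
    exact hp j (by omega)
  exact ((continuousAt_const.fun_mul c1).fun_add ((continuousAt_lameCoeff hτ hp0 hp1).fun_mul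
    (continuousAt_const.fun_mul c2))).fun_sub (continuousAt_const.fun_mul c3)

theorem meromorphicAt_theta1_add (hτ : 0 < τ.im) (a p : ℂ) :
    MeromorphicAt (fun x => theta1 τ (x + a)) p :=
  ((show Differentiable ℂ (fun x => theta1 τ (x + a)) from
    (differentiable_theta1 hτ).comp (by fun_prop)).analyticAt p).meromorphicAt

theorem meromorphicAt_phiSum_add (hτ : 0 < τ.im) (η ζ : ℂ) (ℓ : ℕ) (s : ℕ → ℂ) (a p : ℂ) :
    MeromorphicAt (fun x => phiSum τ η ℓ ζ s (x + a)) p := by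
  unfold phiSum Phi
  refine MeromorphicAt.fun_sum fun j _ => (MeromorphicAt.const (s j) p).fun_mul ?_
  have e1 := meromorphicAt_theta1_add hτ (ζ + a - j * η) p
  have e2 := meromorphicAt_theta1_add hτ (a - j * η) p
  refine (e1.fun_div (e2.fun_mul (MeromorphicAt.const (theta1 τ ζ) p))).congr
    (.of_forall fun x => ?_)
  simp only
  rw [show x + (ζ + a - j * η) = ζ + (x + a - j * η) by ring,
    show x + (a - j * η) = x + a - j * η by ring]

theorem meromorphicAt_lameCoeff (hτ : 0 < τ.im) (η : ℂ) (ℓ : ℕ) (p : ℂ) :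
    MeromorphicAt (lameCoeff τ η ℓ) p := by
  have h := meromorphicAt_theta1_add (τ := τ) hτ
  refine (((h (ℓ * η) p).fun_mul (h (-((ℓ + 1) * η)) p)).fun_div
    ((h 0 p).fun_mul (h (-η) p))).congr (.of_forall fun x => ?_)
  simp only [lameCoeff, sub_eq_add_neg, add_zero]

theorem meromorphicAt_lameDefect (hτ : 0 < τ.im) (η ζ : ℂ) (ℓ : ℕ) (K E : ℂ) (s : ℕ → ℂ) (p : ℂ) :
    MeromorphicAt (lameDefect τ η ℓ ζ K E s) p := by
  have h := meromorphicAt_phiSum_add (τ := τ) hτ η ζ ℓ s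
  refine (((MeromorphicAt.const K p).fun_mul (h η p)).fun_add
    ((meromorphicAt_lameCoeff hτ η ℓ p).fun_mul
      ((MeromorphicAt.const K⁻¹ p).fun_mul (h (-η) p)))).fun_sub
    ((MeromorphicAt.const E p).fun_mul (h 0 p)) |>.congr (.of_forall fun x => ?_)
  simp only [lameDefect, sub_eq_add_neg, add_zero]

/-- Without residues the defect extends to an entire function with multipliers 1 and `e^{-2πiζ}`,
and such a function is zero when ζ is off the lattice. -/
theorem lameDefect_eq_zero_iff (hτ : 0 < τ.im) (hℓ : 1 ≤ ℓ)
    (hη : ∀ j : ℕ, 1 ≤ j → j ≤ 2 * ℓ → theta1 τ (j * η) ≠ 0) (hζ : theta1 τ ζ ≠ 0) (K E : ℂ)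
    {s : ℕ → ℂ} (hs : ∀ j ∉ Finset.Icc 1 ℓ, s j = 0) :
    (∀ x, IsRegularPoint τ η ℓ x → lameDefect τ η ℓ ζ K E s x = 0) ↔
      ∀ m ≤ ℓ, lameResidue τ η ℓ ζ K E s m = 0 := by
  have hne : ∃ y, theta1 τ y ≠ 0 := ⟨ζ, hζ⟩
  constructor
  · intro h m hm
    refine tendsto_nhds_unique (tendsto_theta1_mul_lameDefect hτ hℓ hη hζ K E hs (by omega)) ?_
    refine tendsto_const_nhds.congr' ?_
    filter_upwards [eventually_isRegularPoint hτ hne η ℓ (m * η)] with x hx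
    rw [h x hx, mul_zero]
  · intro h
    set F := lameDefect τ η ℓ ζ K E s with hF
    have hres : ∀ m ≤ ℓ + 1, lameResidue τ η ℓ ζ K E s m = 0 := by
      intro m hm
      rcases hm.eq_or_lt with rfl | hlt
      · exact lameResidue_add_one_eq_zero hℓ K E hs
      · exact h m (by omega)
    have hcont : ∀ p, IsRegularPoint τ η ℓ p → ContinuousAt F p := fun p hp =>
      continuousAt_lameDefect hτ hζ K E s hp
    have hmer : ∀ p, MeromorphicAt F p := meromorphicAt_lameDefect hτ η ζ ℓ K E s
    have hμ : exp (-(2 * Real.pi * I * ζ)) ≠ 0 := exp_ne_zero _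
    have h1 := lameDefect_add_one τ η ℓ ζ K E s
    have h2 := lameDefect_add_tau τ η ℓ ζ K E s
    obtain ⟨c, hc, hder⟩ := exists_hasDerivAt_theta1_zero hτ hne
    have hpole : ∀ p, Tendsto (fun z => (z - p) * F z) (𝓝[≠] p) (𝓝 0) := by
      intro p
      by_cases hp : IsRegularPoint τ η ℓ p
      · have := tendsto_of_continuousAt_punctured
          ((by fun_prop : ContinuousAt (fun z : ℂ => z - p) p).fun_mul (hcont p hp))
        simpa using this
      · simp only [IsRegularPoint, not_forall, not_not] at hp
        obtain ⟨m, hm, hzero⟩ := hp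
        obtain ⟨a, b, hab⟩ := (theta1_eq_zero_iff hτ hne).1 hzero
        obtain rfl : p = m * η + (a + b * τ) := by rw [← hab]; ring
        refine tendsto_sub_mul_add_lattice one_ne_zero hμ h1 h2 ?_ a b
        have hlim := tendsto_theta1_mul_lameDefect hτ hℓ hη hζ K E hs hm
        rw [hres m hm] at hlim
        have hder' : HasDerivAt (fun x => theta1 τ (x - m * η)) c (m * η) := by
          have hd : HasDerivAt (theta1 τ) c (m * η - m * η) := by rwa [sub_self]
          exact hd.comp_sub_const _ _
        have hslope := hasDerivAt_iff_tendsto_slope.1 hder'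
        -- The simple zero of θ₁ converts vanishing of the limit with θ₁(z - mη) into vanishing of
        -- the limit with z - mη.
        have hq := hlim.div hslope hc
        rw [zero_div] at hq
        refine hq.congr' ?_
        filter_upwards [eventually_theta1_sub_ne_zero hτ hne ((m : ℂ) * η) (m * η)] with z hz
        simp only [Pi.div_apply, slope_def_field, sub_self, theta1_zero, sub_zero]
        rw [div_div_eq_mul_div, ← hF, mul_right_comm, mul_assoc, mul_div_cancel_left₀ _ hz]
    obtain ⟨h, hh, hhF⟩ := exists_entire_eventuallyEq hmer hpole
    have hzero : ∀ x, h x = 0 := by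
      by_contra! hx
      obtain ⟨x₀, hx₀⟩ := hx
      obtain ⟨n, hn⟩ := exp_int_mul_of_quasiPeriodic hτ hh hμ
        (fun x => by rw [quasiPeriodic_of_eventuallyEq hh.continuous hhF h1, one_mul])
        (quasiPeriodic_of_eventuallyEq hh.continuous hhF h2) x₀ hx₀
      rw [exp_eq_exp_iff_exists_int] at hn
      obtain ⟨k, hk⟩ := hn
      -- Comparing the multipliers gives ζ = k - nτ, a zero of θ₁.
      refine hζ ((theta1_eq_zero_iff hτ hne).2 ⟨k, -n, ?_⟩)
      apply mul_left_cancel₀ two_pi_I_ne_zero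
      push_cast
      linear_combination hk
    intro x hx
    rw [← hzero x]
    exact (eq_of_eventuallyEq_punctured hh.continuous.continuousAt (hcont x hx) (hhF x)).symm

theorem exists_ansatz_ne_zero_iff (hτ : 0 < τ.im) (hℓ : 1 ≤ ℓ)
    (hη : ∀ j : ℕ, 1 ≤ j → j ≤ 2 * ℓ → theta1 τ (j * η) ≠ 0) (hζ : theta1 τ ζ ≠ 0) (κ : ℂ)
    {s : ℕ → ℂ} (hs : ∀ j ∉ Finset.Icc 1 ℓ, s j = 0) :
    (∃ x, IsRegularPoint τ η ℓ x ∧ ansatz τ η ℓ κ ζ s x ≠ 0) ↔ s ≠ 0 := by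
  constructor
  · rintro ⟨x, -, hx⟩ rfl
    exact hx (by simp [ansatz])
  · intro h
    contrapose! h
    ext m
    by_cases hm : m ∈ Finset.Icc 1 ℓ
    · have hm' := Finset.mem_Icc.1 hm
      refine tendsto_nhds_unique (tendsto_theta1_mul_phiSum hτ hη hζ hs (m := m) (a := 0)
        (k := m) (by ring) (by omega) hℓ) (tendsto_const_nhds.congr' ?_)
      filter_upwards [eventually_isRegularPoint hτ ⟨ζ, hζ⟩ η ℓ (m * η)] with x hx
      have := h x hx
      rw [ansatz_eq, mul_eq_zero, or_iff_right (exp_ne_zero _)] at this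
      simp [this]
    · exact hs m hm

end Limits

end Residues

/-! ### Solving the residue conditions; the spectral curve. -/

section SpectralCurve

open Complex Filter Topology

/-- This form includes the initial condition: at k = ℓ - 1 the out-of-range term is killed by [0] =
0. -/
theorem eval_lameA_recurrence {τ η : ℂ} {ℓ : ℕ} (hℓ : 1 ≤ ℓ)
    (hη : ∀ j : ℕ, 1 ≤ j → j ≤ 2 * ℓ → theta1 τ (j * η) ≠ 0) (E : ℂ) {k : ℕ} (hk : k + 1 ≤ ℓ) :
    ellNum τ η (ℓ + k + 1) * (lameA τ η ℓ k).eval E =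
      ellNum τ η (k + 1) * E * (lameA τ η ℓ (k + 1)).eval E +
        ellNum τ η (ℓ - k - 1) * (lameA τ η ℓ (k + 2)).eval E := by
  have hne : ellNum τ η (ℓ + k + 1) ≠ 0 := by
    exact_mod_cast ellNum_ne_zero hη (n := ℓ + k + 1) (by omega) (by omega)
  rcases hk.eq_or_lt with rfl | hlt
  · have h := lameA_pred τ η hℓ hη
    rw [Nat.add_sub_cancel] at h
    have e : (2 * ((k + 1 : ℕ) : ℤ)) = ((k + 1 : ℕ) : ℤ) + k + 1 := by push_cast; ring
    rw [e] at h
    rw [h, lameA_self τ η hη, show ((k + 1 : ℕ) : ℤ) - k - 1 = 0 by push_cast; ring]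
    simp only [Polynomial.eval_mul, Polynomial.eval_C, Polynomial.eval_X, Polynomial.eval_one,
      ellNum_zero]
    field_simp
    push_cast
    ring
  · have h := lameA_recurrence hη (s := ℓ - k - 1) (by omega) (by omega)
    rw [show ℓ - (ℓ - k - 1) - 1 = k by omega, show ℓ - (ℓ - k - 1) = k + 1 by omega,
      show ℓ - (ℓ - k - 1 : ℕ) = ((k + 1 : ℕ) : ℤ) by omega,
      show 2 * (ℓ : ℤ) - (ℓ - k - 1 : ℕ) = ℓ + k + 1 by omega,
      show ((ℓ - k - 1 : ℕ) : ℤ) = ℓ - k - 1 by omega] at h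
    rw [h]
    simp only [Polynomial.eval_add, Polynomial.eval_mul, Polynomial.eval_C, Polynomial.eval_X]
    field_simp
    push_cast
    ring

theorem ellBinom_zero_right {τ η : ℂ} {n : ℕ} (hn : ellFact τ η n ≠ 0) :
    ellBinom τ η n 0 = 1 := by
  simp [ellBinom, ellFact_zero, hn]

theorem ellBinom_self {τ η : ℂ} {n : ℕ} (hn : ellFact τ η n ≠ 0) : ellBinom τ η n n = 1 := by
  simp [ellBinom, ellFact_zero, hn]

theorem ellBinom_succ_succ {τ η : ℂ} {N : ℕ}
    (hη : ∀ j : ℕ, 1 ≤ j → j ≤ N → theta1 τ (j * η) ≠ 0) {n i : ℕ} (hi : i ≤ n) (hn : n + 1 ≤ N) :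
    ellNum τ η (i + 1) * ellBinom τ η (n + 1) (i + 1) =
      ellNum τ η (n + 1) * ellBinom τ η n i := by
  have h1 := ellFact_ne_zero hη (n := i) (by omega)
  have h2 := ellFact_ne_zero hη (n := n - i) (by omega)
  have h3 : ellNum τ η (i + 1) ≠ 0 := by
    exact_mod_cast ellNum_ne_zero hη (n := i + 1) (by omega) (by omega)
  rw [ellBinom, ellBinom, Nat.add_sub_add_right, ellFact_succ, ellFact_succ]
  field_simp

theorem ellBinom_succ_right {τ η : ℂ} {N : ℕ}
    (hη : ∀ j : ℕ, 1 ≤ j → j ≤ N → theta1 τ (j * η) ≠ 0) {n i : ℕ} (hi : i + 1 ≤ n) (hn : n ≤ N) :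
    ellNum τ η (i + 1) * ellBinom τ η n (i + 1) = ellNum τ η (n - i) * ellBinom τ η n i := by
  obtain ⟨k, rfl⟩ := Nat.exists_eq_add_of_le hi
  have h1 := ellFact_ne_zero hη (n := i) (by omega)
  have h2 := ellFact_ne_zero hη (n := k) (by omega)
  have h3 : ellNum τ η (i + 1) ≠ 0 := by
    exact_mod_cast ellNum_ne_zero hη (n := i + 1) (by omega) (by omega)
  have h4 : ellNum τ η (k + 1) ≠ 0 := by
    exact_mod_cast ellNum_ne_zero hη (n := k + 1) (by omega) (by omega)
  rw [ellBinom, ellBinom, show i + 1 + k - (i + 1) = k by omega,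
    show i + 1 + k - i = k + 1 by omega, show ((i + 1 + k : ℕ) : ℤ) - i = k + 1 by push_cast; ring,
    ellFact_succ, ellFact_succ]
  field_simp

/-- The elliptic binomial coefficient, extended by zero. -/
def ellChoose (τ η : ℂ) (n i : ℕ) : ℂ := if i ≤ n then ellBinom τ η n i else 0

theorem ellChoose_succ_right {τ η : ℂ} {N : ℕ}
    (hη : ∀ j : ℕ, 1 ≤ j → j ≤ N → theta1 τ (j * η) ≠ 0) {n i : ℕ} (hi : i ≤ n) (hn : n ≤ N) :
    ellNum τ η (i + 1) * ellChoose τ η n (i + 1) = ellNum τ η (n - i) * ellChoose τ η n i := by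
  rcases hi.eq_or_lt with rfl | hlt
  · simp [ellChoose]
  · rw [ellChoose, ellChoose, if_pos (Nat.succ_le_of_lt hlt), if_pos hi, ellBinom_succ_right hη hlt hn]

/-- The coefficients `s_j = (-K)^{-j} [ℓ-1 choose j-1] A_j(E)` of the solution, with
`ℓ = L + 1`. -/
def lameSol (τ η : ℂ) (L : ℕ) (K E : ℂ) : ℕ → ℂ
  | 0 => 0
  | i + 1 => (-1) ^ (i + 1) * (K ^ (i + 1))⁻¹ * ellChoose τ η L i * (lameA τ η (L + 1) (i + 1)).eval E

theorem lameSol_eq_zero (τ η : ℂ) (L : ℕ) (K E : ℂ) :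
    ∀ j ∉ Finset.Icc 1 (L + 1), lameSol τ η L K E j = 0 := by
  intro j hj
  cases j with
  | zero => rfl
  | succ i =>
    rw [Finset.mem_Icc] at hj
    rw [lameSol, ellChoose, if_neg (by omega)]
    simp

theorem lameCoeff_mul_eq {τ η : ℂ} {ℓ : ℕ}
    (h0 : theta1 τ η ≠ 0) {i : ℕ} :
    lameCoeff τ η ℓ ((i + 2 : ℕ) * η) =
      -(ellNum τ η (ℓ + i + 2) * ellNum τ η (ℓ - 1 - i)) /
        (ellNum τ η (i + 2) * ellNum τ η (i + 1)) := by
  simp only [lameCoeff, ellNum]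
  rw [show ((i + 2 : ℕ) : ℂ) * η + ℓ * η = ((ℓ + i + 2 : ℤ) : ℂ) * η by push_cast; ring,
    show ((i + 2 : ℕ) : ℂ) * η - (ℓ + 1) * η = -(((ℓ - 1 - i : ℤ) : ℂ) * η) by push_cast; ring,
    show ((i + 2 : ℕ) : ℂ) * η - η = ((i + 1 : ℤ) : ℂ) * η by push_cast; ring,
    show ((i + 2 : ℕ) : ℂ) * η = ((i + 2 : ℤ) : ℂ) * η by push_cast; ring, theta1_neg]
  rw [div_mul_div_comm, div_mul_div_comm, ← neg_div, div_div_div_cancel_right₀ (mul_ne_zero h0 h0),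
    mul_neg]

theorem lameResidue_smul (τ η : ℂ) (ℓ : ℕ) (ζ K E c : ℂ) (s : ℕ → ℂ) (m : ℕ) :
    lameResidue τ η ℓ ζ K E (fun j => c * s j) m = c * lameResidue τ η ℓ ζ K E s m := by
  have hphi : ∀ x, phiSum τ η ℓ ζ (fun j => c * s j) x = c * phiSum τ η ℓ ζ s x := fun x => by
    simp only [phiSum, Finset.mul_sum, mul_assoc]
  match m with
  | 0 => simp only [lameResidue, hphi]; ring
  | 1 => simp only [lameResidue, hphi]; ring
  | m + 2 => simp only [lameResidue]; ring

theorem theta1_ne_zero_of_generic {τ η : ℂ} {L : ℕ}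
    (hη : ∀ j : ℕ, 1 ≤ j → j ≤ 2 * (L + 1) → theta1 τ (j * η) ≠ 0) : theta1 τ η ≠ 0 := by
  simpa using hη 1 le_rfl (by omega)

theorem ellNum_one_of_generic {τ η : ℂ} {L : ℕ}
    (hη : ∀ j : ℕ, 1 ≤ j → j ≤ 2 * (L + 1) → theta1 τ (j * η) ≠ 0) : ellNum τ η 1 = 1 := by
  rw [ellNum, Int.cast_one, one_mul, div_self (theta1_ne_zero_of_generic hη)]

theorem ellNum_ne_zero_of_generic {τ η : ℂ} {L : ℕ}
    (hη : ∀ j : ℕ, 1 ≤ j → j ≤ 2 * (L + 1) → theta1 τ (j * η) ≠ 0) {n : ℤ} (h1 : 1 ≤ n) (h2 : n ≤ 2 * (L + 1)) :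
    ellNum τ η n ≠ 0 := by
  lift n to ℕ using by omega
  exact ellNum_ne_zero hη (by omega) (by omega)

/-- Once powers of -K and ratios of neighbouring binomials are removed, this is the recurrence for
A_{i+1}, A_{i+2}, A_{i+3}. -/
theorem lameResidue_lameSol_eq_zero {τ η : ℂ} {L : ℕ}
    (hη : ∀ j : ℕ, 1 ≤ j → j ≤ 2 * (L + 1) → theta1 τ (j * η) ≠ 0) (ζ : ℂ) {K : ℂ} (hK : K ≠ 0) (E : ℂ) {i : ℕ} (hi : i + 1 ≤ L) :
    lameResidue τ η (L + 1) ζ K E (lameSol τ η L K E) (i + 2) = 0 := by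
  have hrec := eval_lameA_recurrence (by omega) hη E (k := i + 1) (by omega)
  have hb1 := ellChoose_succ_right hη (n := L) (i := i) (by omega) (by omega)
  have hb2 := ellChoose_succ_right hη (n := L) (i := i + 1) (by omega) (by omega)
  have n1 : ellNum τ η (i + 1) ≠ 0 := ellNum_ne_zero_of_generic hη (by omega) (by omega)
  have n2 : ellNum τ η (i + 2) ≠ 0 := ellNum_ne_zero_of_generic hη (by omega) (by omega)
  simp only [lameResidue, lameSol]
  rw [lameCoeff_mul_eq (theta1_ne_zero_of_generic hη)]
  push_cast at hrec hb1 hb2 ⊢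
  rw [show (L : ℤ) + 1 - 1 - i = L - i by ring]
  rw [show (L : ℤ) + 1 + (i + 1) + 1 = L + 1 + i + 2 by ring, show (i : ℤ) + 1 + 1 = i + 2 by ring,
    show (L : ℤ) + 1 - (i + 1) - 1 = L - (i + 1) by ring] at hrec
  rw [show (i : ℤ) + 1 + 1 = i + 2 by ring] at hb2
  simp only [add_assoc, Nat.reduceAdd] at hrec hb1 hb2 ⊢
  have hpow : (-1 : ℂ) ^ (i + 3) = -(-1) ^ (i + 2) := by ring
  have hpow' : (-1 : ℂ) ^ (i + 1) = -(-1) ^ (i + 2) := by ring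
  rw [hpow, hpow', pow_succ K (i + 2), pow_succ K (i + 1)]
  field_simp
  set a1 := (lameA τ η (L + 1) (i + 1)).eval E
  set a2 := (lameA τ η (L + 1) (i + 2)).eval E
  set a3 := (lameA τ η (L + 1) (i + 3)).eval E
  set b0 := ellChoose τ η L i
  set b1 := ellChoose τ η L (i + 1)
  set b2 := ellChoose τ η L (i + 2)
  linear_combination (-1) ^ (i + 2) * (-a3 * ellNum τ η (i + 1) * hb2 -
    ellNum τ η (L + (1 + (i + 2))) * a1 * hb1 + ellNum τ η (i + 1) * b1 * hrec)

theorem lameSol_ne_zero {τ η : ℂ} {L : ℕ}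
    (hη : ∀ j : ℕ, 1 ≤ j → j ≤ 2 * (L + 1) → theta1 τ (j * η) ≠ 0) {K : ℂ} (hK : K ≠ 0) (E : ℂ) :
    lameSol τ η L K E (L + 1) ≠ 0 := by
  have hF := ellFact_ne_zero hη (n := L) (by omega)
  rw [lameSol, ellChoose, if_pos le_rfl, ellBinom_self hF, lameA_self τ η hη]
  simp [hK]

/-- The residue at (i+2)η determines s_{i+1} from the two later coefficients, since `lameCoeff` is
nonzero there. Starting from s_{ℓ+1} = 0, only s_ℓ is free. -/
theorem eq_lameSol_of_lameResidue_eq_zero {τ η : ℂ} {L : ℕ}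
    (hη : ∀ j : ℕ, 1 ≤ j → j ≤ 2 * (L + 1) → theta1 τ (j * η) ≠ 0) (ζ : ℂ) {K : ℂ} (hK : K ≠ 0) (E : ℂ) {s : ℕ → ℂ}
    (hs : ∀ j ∉ Finset.Icc 1 (L + 1), s j = 0)
    (hres : ∀ i, i + 1 ≤ L → lameResidue τ η (L + 1) ζ K E s (i + 2) = 0) :
    ∃ c : ℂ, s = fun j => c * lameSol τ η L K E j := by
  set t := lameSol τ η L K E with ht
  have htL : t (L + 1) ≠ 0 := lameSol_ne_zero hη hK E
  refine ⟨s (L + 1) / t (L + 1), ?_⟩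
  set c := s (L + 1) / t (L + 1) with hc
  have hbase : s (L + 1) = c * t (L + 1) := by rw [hc, div_mul_cancel₀ _ htL]
  have key : ∀ k, k ≤ L → s (L + 1 - k) = c * t (L + 1 - k) ∧
      s (L + 2 - k) = c * t (L + 2 - k) := by
    intro k
    induction k with
    | zero =>
      intro _
      refine ⟨hbase, ?_⟩
      rw [Nat.sub_zero, hs _ (by simp), ht, lameSol_eq_zero _ _ _ _ _ _ (by simp), mul_zero]
    | succ k ih =>
      intro hk
      obtain ⟨h1, h2⟩ := ih (by omega)
      obtain ⟨i, rfl⟩ : ∃ i, L = i + 1 + k := ⟨L - (k + 1), by omega⟩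
      rw [show i + 1 + k + 1 - k = i + 2 by omega] at h1
      rw [show i + 1 + k + 2 - k = i + 3 by omega] at h2
      rw [show i + 1 + k + 1 - (k + 1) = i + 1 by omega,
        show i + 1 + k + 2 - (k + 1) = i + 2 by omega]
      refine ⟨?_, h1⟩
      have e1 := hres i (by omega)
      have e2 := lameResidue_lameSol_eq_zero hη ζ hK E (i := i) (by omega)
      rw [← ht] at e2
      simp only [lameResidue] at e1 e2
      have hco : lameCoeff τ η (i + 1 + k + 1) ((i + 2 : ℕ) * η) ≠ 0 := by
        rw [lameCoeff_mul_eq (theta1_ne_zero_of_generic hη)]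
        refine div_ne_zero (neg_ne_zero.2 (mul_ne_zero ?_ ?_)) (mul_ne_zero ?_ ?_) <;>
          exact ellNum_ne_zero_of_generic hη (by push_cast; omega) (by push_cast; omega)
      apply mul_left_cancel₀ (mul_ne_zero hco (inv_ne_zero hK))
      rw [h1, h2] at e1
      linear_combination e1 - c * e2
  ext j
  by_cases hj : j ∈ Finset.Icc 1 (L + 1)
  · rw [Finset.mem_Icc] at hj
    have := (key (L + 1 - j) (by omega)).1
    rwa [show L + 1 - (L + 1 - j) = j by omega] at this
  · rw [hs j hj, ht, lameSol_eq_zero _ _ _ _ _ j hj, mul_zero]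

theorem sum_Icc_one_eq_sum_range (f : ℕ → ℂ) (n : ℕ) :
    ∑ j ∈ Finset.Icc 1 n, f j = ∑ i ∈ Finset.range n, f (i + 1) := by
  induction n with
  | zero => simp
  | succ n ih => rw [Finset.sum_Icc_succ_top (by omega), ih, Finset.sum_range_succ]

theorem phiSum_lameSol (τ η : ℂ) (L : ℕ) (ζ K E x : ℂ) :
    phiSum τ η (L + 1) ζ (lameSol τ η L K E) x = ∑ i ∈ Finset.range (L + 1),
      (-1) ^ (i + 1) * (K ^ (i + 1))⁻¹ * ellBinom τ η L i * (lameA τ η (L + 1) (i + 1)).eval E *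
        Phi τ (x - (i + 1 : ℕ) * η) ζ := by
  rw [phiSum, sum_Icc_one_eq_sum_range]
  refine Finset.sum_congr rfl fun i hi => ?_
  rw [Finset.mem_range] at hi
  rw [lameSol, ellChoose, if_pos (by omega)]

/-- For j ≥ 1, [j] times the binomial (ℓ, j) is [ℓ] times (ℓ-1, j-1), and θ₁(jη) is the denominator
of Φ(-jη, ζ). The term j = 0 stands alone. -/
theorem spectral1_eq {τ η : ℂ} {L : ℕ}
    (hη : ∀ j : ℕ, 1 ≤ j → j ≤ 2 * (L + 1) → theta1 τ (j * η) ≠ 0) {ζ : ℂ}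
    (hζ : theta1 τ ζ ≠ 0) {K : ℂ} (hK : K ≠ 0) (E : ℂ) :
    spectral1 τ η (L + 1) ζ K E = theta1 τ ζ * (lameA τ η (L + 1) 0).eval E +
      theta1 τ ζ * theta1 τ (-((L + 1 : ℕ) * η)) *
        phiSum τ η (L + 1) ζ (lameSol τ η L K E) 0 := by
  have hθ := theta1_ne_zero_of_generic hη
  rw [spectral1, Finset.sum_range_succ', add_comm, phiSum_lameSol, Finset.mul_sum]
  congr 1
  · rw [ellBinom_zero_right (ellFact_ne_zero hη (by omega))]
    simp
  · refine Finset.sum_congr rfl fun i hi => ?_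
    rw [Finset.mem_range] at hi
    have hb := ellBinom_succ_succ hη (n := L) (i := i) (by omega) (by omega)
    have h1 := hη (i + 1) (by omega) (by omega)
    simp only [ellNum] at hb
    field_simp at hb
    rw [zpow_neg, zpow_natCast, Phi, zero_sub, ← sub_eq_add_neg, theta1_neg, theta1_neg]
    push_cast at hb h1 ⊢
    field_simp
    linear_combination (theta1 τ (ζ - (i + 1) * η) * (lameA τ η (L + 1) (i + 1)).eval E) * hb

/-- The recurrence at k = 0 turns K s_2 - E s_1 into K⁻¹[ℓ+1]A_0, the isolated term of
`spectral1_eq`. -/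
theorem lameResidue_lameSol_one {τ η : ℂ} {L : ℕ}
    (hη : ∀ j : ℕ, 1 ≤ j → j ≤ 2 * (L + 1) → theta1 τ (j * η) ≠ 0) {ζ : ℂ}
    (hζ : theta1 τ ζ ≠ 0) {K : ℂ} (hK : K ≠ 0) (E : ℂ) :
    lameResidue τ η (L + 1) ζ K E (lameSol τ η L K E) 1 =
      K⁻¹ * ellNum τ η (L + 2) / theta1 τ ζ * spectral1 τ η (L + 1) ζ K E := by
  have hrec := eval_lameA_recurrence (by omega) hη E (k := 0) (by omega)
  have hb := ellChoose_succ_right hη (n := L) (i := 0) (by omega) (by omega)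
  have hb0 : ellChoose τ η L 0 = 1 := by
    rw [ellChoose, if_pos (Nat.zero_le _), ellBinom_zero_right (ellFact_ne_zero hη (by omega))]
  have hL2 : theta1 τ (η + (L + 1 : ℕ) * η) / theta1 τ η = ellNum τ η (L + 2) := by
    rw [ellNum]
    congr 2
    push_cast
    ring
  rw [spectral1_eq hη hζ hK, lameResidue, mul_div_right_comm, hL2]
  simp only [lameSol, hb0]
  rw [hb0] at hb
  push_cast at hrec hb ⊢
  simp only [add_zero, sub_zero, add_sub_cancel_right,
    ellNum_one_of_generic hη, one_mul, mul_one, show (L : ℤ) + 1 + 1 = L + 2 by ring] at hrec hb ⊢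
  rw [hb]
  field_simp
  linear_combination -hrec

/-- The term j = 1 drops out by [0] = 0, and j = 0 gives -θ₁(ζ)A_1 because [-1] = -1. For j ≥ 2 the
binomial is lowered twice, leaving the denominator of Φ(-jη, ζ). -/
theorem spectral2_eq {τ η : ℂ} {L : ℕ}
    (hη : ∀ j : ℕ, 1 ≤ j → j ≤ 2 * (L + 1) → theta1 τ (j * η) ≠ 0) {ζ : ℂ}
    (hζ : theta1 τ ζ ≠ 0) {K : ℂ} (hK : K ≠ 0) (E : ℂ) :
    spectral2 τ η (L + 1) ζ K E = -theta1 τ ζ * (lameA τ η (L + 1) 1).eval E +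
      theta1 τ ζ * theta1 τ ((L + 1 : ℕ) * η) * ellNum τ η (L + 2) * K⁻¹ *
        phiSum τ η (L + 1) ζ (lameSol τ η L K E) (-η) := by
  have hθ := theta1_ne_zero_of_generic hη
  by_cases hL2 : ellFact τ η (L + 1 + 1) = 0
  · rw [ellFact_succ, mul_eq_zero, or_iff_left (ellFact_ne_zero hη (by omega))] at hL2
    exact absurd hL2 (ellNum_ne_zero_of_generic hη (by omega) (by push_cast; omega))
  rw [spectral2, Finset.sum_range_succ', Finset.sum_range_succ', add_assoc, add_comm,
    phiSum_lameSol, Finset.mul_sum]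
  congr 1
  · rw [ellBinom_zero_right hL2]
    simp [ellNum_neg, ellNum_one_of_generic hη]
  · refine Finset.sum_congr rfl fun i hi => ?_
    rw [Finset.mem_range] at hi
    have hb1 := ellBinom_succ_succ hη (n := L) (i := i) (by omega) (by omega)
    have hb2 := ellBinom_succ_succ hη (n := L + 1) (i := i + 1) (by omega) (by omega)
    have h1 := hη (i + 1) (by omega) (by omega)
    have h2 := hη (i + 1 + 1) (by omega) (by omega)
    rw [show ((i + 1 + 1 : ℕ) : ℤ) - 1 = (i + 1 : ℕ) by push_cast; ring, Int.natAbs_natCast]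
    rw [zpow_neg, zpow_natCast, Phi, show -η - (i + 1 : ℕ) * η = -((i + 1 + 1 : ℕ) * η) by
      push_cast; ring, ← sub_eq_add_neg, theta1_neg]
    simp only [ellNum] at hb1 hb2 ⊢
    push_cast at hb1 hb2 h1 h2 ⊢
    simp only [add_assoc, one_add_one_eq_two] at hb1 hb2 h1 h2 ⊢
    rw [show (-1 : ℂ) ^ (i + 2) = -(-1) ^ (i + 1) by ring,
      show K ^ (i + 2) = K ^ (i + 1) * K by ring]
    rw [mul_comm ((i : ℂ) + 2) η] at h2 hb2 ⊢
    field_simp at hb1 hb2 ⊢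
    linear_combination (theta1 τ (ζ - η * (i + 2)) * (lameA τ η (L + 1) (i + 1)).eval E) *
      (-theta1 τ ((i + 1) * η) * hb2 - theta1 τ (η * (L + 2)) * hb1)

theorem lameResidue_lameSol_zero {τ η : ℂ} {L : ℕ}
    (hη : ∀ j : ℕ, 1 ≤ j → j ≤ 2 * (L + 1) → theta1 τ (j * η) ≠ 0) {ζ : ℂ}
    (hζ : theta1 τ ζ ≠ 0) {K : ℂ} (hK : K ≠ 0) (E : ℂ) :
    lameResidue τ η (L + 1) ζ K E (lameSol τ η L K E) 0 =
      (theta1 τ ζ)⁻¹ * spectral2 τ η (L + 1) ζ K E := by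
  have hb0 : ellChoose τ η L 0 = 1 := by
    rw [ellChoose, if_pos (Nat.zero_le _), ellBinom_zero_right (ellFact_ne_zero hη (by omega))]
  have hL2 : theta1 τ (-(((L + 1 : ℕ) + 1) * η)) / theta1 τ (-η) = ellNum τ η (L + 2) := by
    rw [ellNum, theta1_neg, theta1_neg, neg_div_neg_eq]
    congr 2
    push_cast
    ring
  rw [spectral2_eq hη hζ hK, lameResidue, mul_div_assoc, hL2]
  simp only [lameSol, hb0]
  field_simp
  ring

theorem hasDoubleBlochSolution_iff {τ η : ℂ} (hτ : 0 < τ.im) {L : ℕ}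
    (hη : ∀ j : ℕ, 1 ≤ j → j ≤ 2 * (L + 1) → theta1 τ (j * η) ≠ 0) {ζ : ℂ}
    (hζ : theta1 τ ζ ≠ 0) (κ E : ℂ) :
    HasDoubleBlochSolution τ η (L + 1) κ ζ E ↔
      spectral1 τ η (L + 1) ζ (exp κ) E = 0 ∧ spectral2 τ η (L + 1) ζ (exp κ) E = 0 := by
  have hK : exp κ ≠ 0 := exp_ne_zero κ
  have hη0 : η ≠ 0 := by
    rintro rfl
    exact theta1_ne_zero_of_generic hη (theta1_zero τ)
  have hL2 : ellNum τ η (L + 2) ≠ 0 := ellNum_ne_zero_of_generic hη (by omega) (by omega)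
  have hres1 := lameResidue_lameSol_one hη hζ hK E
  have hres0 := lameResidue_lameSol_zero hη hζ hK E
  constructor
  · rintro ⟨s, ⟨x, hx, hsx⟩, -, hsol⟩
    -- Values of s outside 1, …, ℓ do not enter the ansatz, but the residue formulas need them to be
    -- zero.
    set u : ℕ → ℂ := fun j => if j ∈ Finset.Icc 1 (L + 1) then s j else 0 with hu
    have hsu : ansatz τ η (L + 1) κ ζ s = ansatz τ η (L + 1) κ ζ u := by
      ext y
      simp only [ansatz]
      congr 1
      refine Finset.sum_congr rfl fun j hj => ?_
      rw [hu]
      simp only [hj, if_true]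
    have hu0 : ∀ j ∉ Finset.Icc 1 (L + 1), u j = 0 := fun j hj => if_neg hj
    rw [hsu] at hsx hsol
    have hune := (exists_ansatz_ne_zero_iff hτ (by omega) hη hζ κ hu0).1 ⟨x, hx, hsx⟩
    have hr := (lameDefect_eq_zero_iff hτ (by omega) hη hζ (exp κ) E hu0).1
      ((solvesLame_ansatz_iff hη0 (L + 1) ζ κ E u).1 hsol)
    obtain ⟨c, hc⟩ := eq_lameSol_of_lameResidue_eq_zero hη ζ hK E hu0
      fun i hi => hr (i + 2) (by omega)
    have hc0 : c ≠ 0 := by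
      rintro rfl
      exact hune (by rw [hc]; ext j; simp)
    have r1 := hr 1 (by omega)
    have r0 := hr 0 (by omega)
    rw [hc, lameResidue_smul] at r1 r0
    rw [hres1] at r1
    rw [hres0] at r0
    simpa [hc0, hK, hζ, hL2] using And.intro r1 r0
  · rintro ⟨h1, h2⟩
    have ht0 := lameSol_eq_zero τ η L (exp κ) E
    refine ⟨lameSol τ η L (exp κ) E, ?_, isDoubleBloch_ansatz _ _ _ _ _ _, ?_⟩
    · refine (exists_ansatz_ne_zero_iff hτ (by omega) hη hζ κ ht0).2 fun h => ?_
      exact lameSol_ne_zero hη hK E (congrFun h (L + 1))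
    · rw [solvesLame_ansatz_iff hη0, lameDefect_eq_zero_iff hτ (by omega) hη hζ (exp κ) E ht0]
      intro m hm
      match m with
      | 0 => rw [hres0, h2, mul_zero]
      | 1 => rw [hres1, h1, mul_zero]
      | i + 2 => exact lameResidue_lameSol_eq_zero hη ζ hK E (by omega)

end SpectralCurve

end DifferenceLame

end

theorem theorem3p1 (τ η : ℂ) (hτ : 0 < τ.im) (ℓ : ℕ) (hℓ : 1 ≤ ℓ)
    (hη : ∀ j : ℕ, 1 ≤ j → j ≤ 2 * ℓ → DifferenceLame.theta1 τ (j * η) ≠ 0) :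
    (∀ ζ κ K E : ℂ, DifferenceLame.theta1 τ ζ ≠ 0 → Complex.exp κ = K →
      (DifferenceLame.HasDoubleBlochSolution τ η ℓ κ ζ E ↔
        DifferenceLame.spectral1 τ η ℓ ζ K E = 0 ∧
        DifferenceLame.spectral2 τ η ℓ ζ K E = 0)) ∧
    (∀ j : ℕ, j ≤ ℓ → (DifferenceLame.lameA τ η ℓ j).degree = ((ℓ - j : ℕ) : WithBot ℕ)) ∧
    DifferenceLame.lameA τ η ℓ ℓ = 1 ∧
    (∀ P : ℕ → Polynomial ℂ,
      DifferenceLame.SatisfiesRecurrence τ η ℓ P ↔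
        ∀ j : ℕ, j ≤ ℓ → P j = DifferenceLame.lameA τ η ℓ j) := by
  have hA := DifferenceLame.satisfiesRecurrence_lameA hℓ hη
  refine ⟨?_, fun j hj => DifferenceLame.degree_lameA hℓ hη hj,
    DifferenceLame.lameA_self τ η hη, fun P => ⟨fun hP j hj =>
      DifferenceLame.eq_of_satisfiesRecurrence hP hA hj, fun h =>
      DifferenceLame.satisfiesRecurrence_congr hA h⟩⟩
  rintro ζ κ K E hζ rfl
  -- With ℓ = L + 1 the binomials (ℓ-1, j-1) avoid truncated subtraction.
  obtain ⟨L, rfl⟩ := Nat.exists_eq_add_of_le' hℓ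
  exact DifferenceLame.hasDoubleBlochSolution_iff hτ hη hζ κ E
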